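/- Let $d\ge 1$ be an integer. For $0<\epsilon<1$ let $V_\epsilon=(\epsilon\mathbb{Z}^d)\cap[0,1)^d$. The modified branching random walk (MBRW) is the centered Gaussian field $\{\xi_\epsilon^v(t): v\in V_\epsilon,\ 0\le t\le \log(1/\epsilon)\}$ with covariance $$\mathrm{Cov}\big(\xi_\epsilon^v(t),\xi_\epsilon^u(s)\big)=\int_0^{\min\{t,s\}}\prod_{i=1}^d\big(1-e^r|v_i-u_i|\big)_+\,dr ,$$ where $(x)_+=\max\{x,0\}$. Write $\xi_\epsilon^v=\xi_\epsilon^v(\log(1/\epsilon))$ and $$m_\epsilon=\sqrt{2d}\,\log(1/\epsilon)-\frac{3/2}{\sqrt{2d}}\log\log(1/\epsilon).$$ Let $\rho>0$. Then there exist constants $0<c,C<\infty$ and $\epsilon_0>0$, depending only on $\rho$ and $d$, such that $$\mathbb{P}\Big(\max_{v\in V_\epsilon\cap\rho[0,1]^d}\xi_\epsilon^v\le m_\epsilon-\lambda\Big)\le Ce^{-c\lambda}$$ for all $\lambda\ge 0$ and all $0<\epsilon<\epsilon_0$. -/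

import Mathlib

open MeasureTheory ProbabilityTheory

noncomputable section

/-- The discretized box `V_ε = (ε ℤ^d) ∩ [0,1)^d`. -/
def gridBox (d : ℕ) (ε : ℝ) : Set (Fin d → ℝ) :=
  {v | (∃ n : Fin d → ℤ, ∀ i, v i = ε * n i) ∧ ∀ i, v i ∈ Set.Ico (0 : ℝ) 1}

/-- The set `V_ε ∩ ρ[0,1]^d`. -/
def gridSubBox (d : ℕ) (ε ρ : ℝ) : Set (Fin d → ℝ) :=
  gridBox d ε ∩ {v | ∀ i, v i ∈ Set.Icc (0 : ℝ) ρ}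

/-- The covariance
`∫_0^{min(t,s)} ∏_{i} (1 - e^r |v_i - u_i|)_+ dr` of the modified branching random walk. -/
def mbrwCov {d : ℕ} (v : Fin d → ℝ) (t : ℝ) (u : Fin d → ℝ) (s : ℝ) : ℝ :=
  ∫ r in (0 : ℝ)..(min t s), ∏ i : Fin d, max (1 - Real.exp r * |v i - u i|) 0

/-- `ξ` is a modified branching random walk (MBRW) at scale `ε` under `P`: the family
`(ξ v t : v ∈ V_ε, 0 ≤ t ≤ log (1/ε))` is a centered (jointly) Gaussian field with
covariance `mbrwCov`. The values of `ξ` at other indices play no role. -/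
structure IsMBRW {Ω : Type*} [MeasurableSpace Ω] (d : ℕ) (ε : ℝ)
    (ξ : (Fin d → ℝ) → ℝ → Ω → ℝ) (P : Measure Ω) : Prop where
  gaussian : IsGaussianProcess
    (fun p : gridBox d ε × Set.Icc (0 : ℝ) (Real.log (1 / ε)) =>
      ξ (p.1 : Fin d → ℝ) (p.2 : ℝ)) P
  centered : ∀ v ∈ gridBox d ε, ∀ t ∈ Set.Icc (0 : ℝ) (Real.log (1 / ε)),
    ∫ ω, ξ v t ω ∂P = 0
  covariance_eq : ∀ v ∈ gridBox d ε, ∀ u ∈ gridBox d ε,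
    ∀ t ∈ Set.Icc (0 : ℝ) (Real.log (1 / ε)), ∀ s ∈ Set.Icc (0 : ℝ) (Real.log (1 / ε)),
      covariance (ξ v t) (ξ u s) P = mbrwCov v t u s

/-- The centering
`m_ε = √(2d) log(1/ε) - ((3/2)/√(2d)) log log(1/ε)`. -/
def mEps (d : ℕ) (ε : ℝ) : ℝ :=
  Real.sqrt (2 * d) * Real.log (1 / ε)
    - (3 / 2) / Real.sqrt (2 * d) * Real.log (Real.log (1 / ε))

/-- The maximum over `v ∈ V_ε ∩ ρ[0,1]^d` of the terminal values `ξ^v = ξ^v(log (1/ε))`.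
The supremum is over a finite nonempty set, see `isGreatest_mbrwMax`. -/
def mbrwMax {Ω : Type*} {d : ℕ} (ε ρ : ℝ) (ξ : (Fin d → ℝ) → ℝ → Ω → ℝ) (ω : Ω) : ℝ :=
  sSup ((fun v => ξ v (Real.log (1 / ε)) ω) '' gridSubBox d ε ρ)

theorem finite_gridBox (d : ℕ) {ε : ℝ} (hε : 0 < ε) : (gridBox d ε).Finite := by
  have h : (Set.univ.pi fun _ : Fin d =>
      (fun n : ℤ => ε * (n : ℝ)) '' Set.Icc 0 ⌈1 / ε⌉).Finite :=
    Set.Finite.pi fun _ => (Set.finite_Icc _ _).image _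
  refine h.subset ?_
  rintro v ⟨⟨n, hn⟩, hv⟩ i -
  have h0 := (hv i).1
  have h1 := (hv i).2
  rw [hn i] at h0 h1
  refine ⟨n i, ⟨?_, ?_⟩, (hn i).symm⟩
  · exact_mod_cast nonneg_of_mul_nonneg_right h0 hε
  · have h2 : (n i : ℝ) ≤ 1 / ε := by
      rw [le_div_iff₀ hε]; linarith
    exact_mod_cast h2.trans (Int.le_ceil _)

theorem zero_mem_gridSubBox (d : ℕ) (ε : ℝ) {ρ : ℝ} (hρ : 0 < ρ) :
    (0 : Fin d → ℝ) ∈ gridSubBox d ε ρ :=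
  ⟨⟨⟨0, by simp⟩, by simp⟩, by simpa using fun _ => hρ.le⟩

/-- `mbrwMax` is a genuine maximum. -/
theorem isGreatest_mbrwMax {Ω : Type*} {d : ℕ} {ε ρ : ℝ} (hε : 0 < ε) (hρ : 0 < ρ)
    (ξ : (Fin d → ℝ) → ℝ → Ω → ℝ) (ω : Ω) :
    IsGreatest ((fun v => ξ v (Real.log (1 / ε)) ω) '' gridSubBox d ε ρ)
      (mbrwMax ε ρ ξ ω) := by
  have hf := ((finite_gridBox d hε).subset
    (Set.inter_subset_left : gridSubBox d ε ρ ⊆ _)).image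
      (fun v => ξ v (Real.log (1 / ε)) ω)
  have hne : ((fun v => ξ v (Real.log (1 / ε)) ω) '' gridSubBox d ε ρ).Nonempty :=
    ⟨_, 0, zero_mem_gridSubBox d ε hρ, rfl⟩
  exact ⟨hne.csSup_mem hf, fun _ hx => le_csSup hf.bddAbove hx⟩

end

/-! Write T = log(1/ε), b = √(2d), and let m_T denote the centering. The kernel of points at
distance at least e^{-t₀} vanishes after time t₀. Hence a number of order e^{t₀} of well separated
boxes of side about e^{-t₀}, placed on the diagonal, have independent increments over [t₀, T]. In
each box some increment exceeds m_{T-t₀} with probability bounded below, so all boxes fail with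
probability exponentially small in their number. The field at time t₀ is independent of these
increments. At a point chosen from the increments it is therefore still a centered Gaussian of
variance t₀, and a Chernoff bound controls the chance that it lies below -λ/2. With t₀ = λ/(2b) one
has m_T - λ ≤ m_{T-t₀} - λ/2, and both errors are exponential in λ
(`IsMBRW.exists_measureReal_forall_le`). If T - t₀ < 1, the Gaussian tail at a single point
suffices.

The bound for one box (`IsBranchingIncrements.exists_le_prob_maxHeight`) is a second moment argument
with the linear barrier 1 + μt, μ = m_T/T, counting walks that end within one unit below it. Only
discrete times are used: each step is weighted by the probability that a Brownian bridge between its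
endpoints avoids the barrier. The weighted walk then has exactly the kernel of Brownian motion with
drift killed at the barrier, known from reflection and an exponential tilt
(`killedStep_iterate_eq`). Its T^{-3/2} decay cancels the T^{3/2} produced by the logarithm in m_T,
so each walk contributes order e^{-dT}.

For a pair splitting at time s, the walks before s are correlated but not equal. There the product
of their survival weights is at most either factor. After s independence and ab ≤ a² + b² reduce the
pair to an integral over one walk (`IsBranchingIncrements.lintegral_hitWeight_mul_le`). The result
e^{-d(2T-s)}, times at most order e^{d(T-s)} partners, leaves e^{-dT} times a weight that is
summable over s. -/

open scoped ENNReal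

/-! ### Heat kernels and the reflection principle -/

/-- The heat kernel on the line. -/
noncomputable def heat (t z : ℝ) : ℝ := (Real.sqrt (2 * Real.pi * t))⁻¹ * Real.exp (-z ^ 2 / (2 * t))

/-- The heat kernel on the half-line with absorption at the origin. -/
noncomputable def killedHeat (t x y : ℝ) : ℝ := heat t (x - y) - heat t (x + y)

theorem heat_eq_gaussianPDFReal {t : ℝ} (ht : 0 ≤ t) (m y : ℝ) :
    heat t (y - m) = gaussianPDFReal m t.toNNReal y := by
  simp [heat, gaussianPDFReal, Real.coe_toNNReal t ht]

theorem heat_nonneg (t z : ℝ) : 0 ≤ heat t z := by unfold heat; positivity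

theorem heat_neg (t z : ℝ) : heat t (-z) = heat t z := by simp [heat]

theorem measurable_killedHeat (t x : ℝ) : Measurable (killedHeat t x) := by
  unfold killedHeat heat; fun_prop

theorem measurable_killedHeat_left (t y : ℝ) : Measurable fun x => killedHeat t x y := by
  unfold killedHeat heat; fun_prop

theorem integrable_heat {t : ℝ} (ht : 0 < t) (m : ℝ) : Integrable fun y => heat t (y - m) := by
  simp_rw [heat_eq_gaussianPDFReal ht.le]
  exact integrable_gaussianPDFReal _ _

theorem integral_heat {t : ℝ} (ht : 0 < t) (m : ℝ) : ∫ y, heat t (y - m) = 1 := by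
  simp_rw [heat_eq_gaussianPDFReal ht.le]
  exact integral_gaussianPDFReal_eq_one _ (by simpa using ht)

/-- Completing the square in y: the second factor on the right is the density of the Brownian bridge
at the intermediate time. -/
theorem heat_mul_heat {s t : ℝ} (hs : 0 < s) (ht : 0 < t) (x y z : ℝ) :
    heat s (x - y) * heat t (y - z) =
      heat (s + t) (x - z) * heat (s * t / (s + t)) (y - (t * x + s * z) / (s + t)) := by
  unfold heat
  have hst : 0 < s + t := add_pos hs ht
  have h1 : (Real.sqrt (2 * Real.pi * s))⁻¹ * (Real.sqrt (2 * Real.pi * t))⁻¹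
      = (Real.sqrt (2 * Real.pi * (s + t)))⁻¹ * (Real.sqrt (2 * Real.pi * (s * t / (s + t))))⁻¹ := by
    rw [← mul_inv, ← mul_inv, ← Real.sqrt_mul (by positivity), ← Real.sqrt_mul (by positivity)]
    congr 2; field_simp
  have h2 : -(x - y) ^ 2 / (2 * s) + -(y - z) ^ 2 / (2 * t) = -(x - z) ^ 2 / (2 * (s + t)) +
      -(y - (t * x + s * z) / (s + t)) ^ 2 / (2 * (s * t / (s + t))) := by
    field_simp; ring
  calc _ = ((Real.sqrt (2 * Real.pi * s))⁻¹ * (Real.sqrt (2 * Real.pi * t))⁻¹) *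
        Real.exp (-(x - y) ^ 2 / (2 * s) + -(y - z) ^ 2 / (2 * t)) := by rw [Real.exp_add]; ring
    _ = _ := by rw [h1, h2, Real.exp_add]; ring

theorem integrable_heat_mul_heat {s t : ℝ} (hs : 0 < s) (ht : 0 < t) (x z : ℝ) :
    Integrable fun y => heat s (x - y) * heat t (y - z) := by
  simp_rw [heat_mul_heat hs ht]
  exact (integrable_heat (by positivity) _).const_mul _

theorem integral_heat_mul_heat {s t : ℝ} (hs : 0 < s) (ht : 0 < t) (x z : ℝ) :
    ∫ y, heat s (x - y) * heat t (y - z) = heat (s + t) (x - z) := by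
  simp_rw [heat_mul_heat hs ht]
  rw [integral_const_mul, integral_heat (by positivity), mul_one]

/-- The factor 1 - exp(-2xy/t) is the bridge survival probability, which lets `bridgeSurvival` turn
a free Gaussian step into a killed one. -/
theorem killedHeat_eq {t : ℝ} (ht : 0 < t) (x y : ℝ) :
    killedHeat t x y = heat t (x - y) * (1 - Real.exp (-(2 * x * y / t))) := by
  unfold killedHeat heat
  rw [mul_sub, mul_one, mul_assoc _ (Real.exp _) (Real.exp _), ← Real.exp_add]
  congr 3
  field_simp; ring

theorem killedHeat_nonneg {t x y : ℝ} (ht : 0 < t) (hx : 0 < x) (hy : 0 < y) :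
    0 ≤ killedHeat t x y := by
  rw [killedHeat_eq ht]
  have : Real.exp (-(2 * x * y / t)) ≤ 1 := Real.exp_le_one_iff.2 (by simp; positivity)
  exact mul_nonneg (heat_nonneg _ _) (by linarith)

theorem killedHeat_mul_killedHeat (s t x y z : ℝ) :
    killedHeat s x y * killedHeat t y z =
      (heat s (x - y) * heat t (y - z) - heat s (x - y) * heat t (y - (-z)))
      + (heat s (-x - y) * heat t (y - (-z)) - heat s (-x - y) * heat t (y - z)) := by
  have : heat s (-x - y) = heat s (x + y) := by rw [← heat_neg]; congr 1; ring
  rw [this, sub_neg_eq_add]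
  unfold killedHeat; ring

theorem integrable_killedHeat_mul {s t : ℝ} (hs : 0 < s) (ht : 0 < t) (x z : ℝ) :
    Integrable fun y => killedHeat s x y * killedHeat t y z := by
  simp_rw [killedHeat_mul_killedHeat]
  have H := integrable_heat_mul_heat hs ht
  exact ((H x z).sub (H x (-z))).add ((H (-x) (-z)).sub (H (-x) z))

/-- Chapman–Kolmogorov with absorption. Each factor is odd in y, so the product is even and the
half-line integral is half of a whole-line integral of free kernels. -/
theorem integral_killedHeat_mul {s t : ℝ} (hs : 0 < s) (ht : 0 < t) (x z : ℝ) :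
    ∫ y in Set.Ioi 0, killedHeat s x y * killedHeat t y z = killedHeat (s + t) x z := by
  have H := integrable_heat_mul_heat hs ht
  have h1 : ∫ y, killedHeat s x y * killedHeat t y z = 2 * killedHeat (s + t) x z := by
    simp_rw [killedHeat_mul_killedHeat]
    rw [integral_add (f := fun y => _ - _) (g := fun y => _ - _) ((H x z).sub (H x (-z)))
      ((H (-x) (-z)).sub (H (-x) z)), integral_sub (H x z) (H x (-z)), integral_sub (H (-x) (-z)) (H (-x) z)]
    simp_rw [integral_heat_mul_heat hs ht]
    have e1 : heat (s + t) (-x - -z) = heat (s + t) (x - z) := by rw [← heat_neg]; congr 1; ring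
    have e2 : heat (s + t) (-x - z) = heat (s + t) (x + z) := by rw [← heat_neg]; congr 1; ring
    rw [e1, e2, sub_neg_eq_add]; unfold killedHeat; ring
  have h2 := integral_comp_abs (f := fun y => killedHeat s x y * killedHeat t y z)
  have h3 : (fun y => killedHeat s x |y| * killedHeat t |y| z)
      = fun y => killedHeat s x y * killedHeat t y z := by
    ext y
    rcases abs_cases y with ⟨h, -⟩ | ⟨h, -⟩
    · rw [h]
    · rw [h]; unfold killedHeat
      rw [sub_neg_eq_add, ← sub_eq_add_neg, show -y - z = -(y + z) by ring,
        show -y + z = -(y - z) by ring, heat_neg, heat_neg]; ring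
  simp only [h3, h1] at h2
  linarith

theorem lintegral_killedHeat_mul {s t x z : ℝ} (hs : 0 < s) (ht : 0 < t) (hx : 0 < x) (hz : 0 < z) :
    ∫⁻ y in Set.Ioi 0, ENNReal.ofReal (killedHeat s x y) * ENNReal.ofReal (killedHeat t y z)
      = ENNReal.ofReal (killedHeat (s + t) x z) := by
  rw [← integral_killedHeat_mul hs ht, ofReal_integral_eq_lintegral_ofReal
    (integrable_killedHeat_mul hs ht x z).integrableOn]
  · refine setLIntegral_congr_fun measurableSet_Ioi fun y hy => ?_
    rw [ENNReal.ofReal_mul (killedHeat_nonneg hs hx hy)]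
  · refine (ae_restrict_iff' measurableSet_Ioi).2 (.of_forall fun y hy => ?_)
    exact mul_nonneg (killedHeat_nonneg hs hx hy) (killedHeat_nonneg ht hy hz)

/-- The bound 1 - e^{-u} ≤ u gains a factor 1/t over the free kernel. The resulting t^{-3/2} is the
origin of the constant 3/2 in the centering. -/
theorem killedHeat_le {t x y : ℝ} (ht : 0 < t) (hx : 0 < x) (hy : 0 < y) :
    killedHeat t x y ≤ x * y * (Real.sqrt t * t)⁻¹ := by
  rw [killedHeat_eq ht]
  have h1 : 1 - Real.exp (-(2 * x * y / t)) ≤ 2 * x * y / t := by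
    have := Real.add_one_le_exp (-(2 * x * y / t)); linarith
  have h1' : 0 ≤ 1 - Real.exp (-(2 * x * y / t)) := by
    have : Real.exp (-(2 * x * y / t)) ≤ 1 := Real.exp_le_one_iff.2 (by simp; positivity)
    linarith
  have h2 : heat t (x - y) ≤ (2 * Real.sqrt t)⁻¹ := by
    unfold heat
    have : 2 * Real.sqrt t ≤ Real.sqrt (2 * Real.pi * t) := by
      have : Real.sqrt (2 ^ 2 * t) = 2 * Real.sqrt t := by
        rw [Real.sqrt_mul (by positivity), Real.sqrt_sq (by norm_num)]
      rw [← this]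
      refine Real.sqrt_le_sqrt ?_
      nlinarith [Real.pi_gt_three]
    calc _ ≤ (Real.sqrt (2 * Real.pi * t))⁻¹ * 1 := by
          gcongr
          exact Real.exp_le_one_iff.2 (div_nonpos_of_nonpos_of_nonneg (by nlinarith [sq_nonneg (x-y)]) (by positivity))
      _ ≤ _ := by
          rw [mul_one]
          exact inv_anti₀ (by positivity) this
  calc _ ≤ (2 * Real.sqrt t)⁻¹ * (2 * x * y / t) := by gcongr
    _ = _ := by field_simp

theorem le_killedHeat_one {t y : ℝ} (ht : 1 ≤ t) (hy : 0 < y) (hy1 : y ≤ 1) :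
    Real.exp (-3) / 2 * y * (Real.sqrt t * t)⁻¹ ≤ killedHeat t 1 y := by
  have ht0 : 0 < t := by linarith
  rw [killedHeat_eq ht0]
  have h1 : Real.exp (-2) * (2 * y / t) ≤ 1 - Real.exp (-(2 * 1 * y / t)) := by
    have hu : 2 * y / t ≤ 2 := by rw [div_le_iff₀ ht0]; linarith
    have hu0 : 0 ≤ 2 * y / t := by positivity
    rw [mul_one]
    set u := 2 * y / t
    have e1 := Real.add_one_le_exp u
    have e2 : Real.exp (-u) * Real.exp u = 1 := by rw [← Real.exp_add]; simp
    have e3 : Real.exp (-2) ≤ Real.exp (-u) := Real.exp_le_exp.2 (by linarith)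
    have e4 : 0 < Real.exp (-u) := Real.exp_pos _
    calc _ ≤ Real.exp (-u) * u := by gcongr
      _ ≤ _ := by nlinarith
  have h2 : Real.exp (-1) * (4 * Real.sqrt t)⁻¹ ≤ heat t (1 - y) := by
    unfold heat
    have : Real.sqrt (2 * Real.pi * t) ≤ 4 * Real.sqrt t := by
      have : Real.sqrt (4 ^ 2 * t) = 4 * Real.sqrt t := by
        rw [Real.sqrt_mul (by positivity), Real.sqrt_sq (by norm_num)]
      rw [← this]
      refine Real.sqrt_le_sqrt ?_
      nlinarith [Real.pi_le_four]
    rw [mul_comm]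
    refine mul_le_mul (inv_anti₀ (by positivity) this) (Real.exp_le_exp.2 ?_) (Real.exp_pos _).le
      (by positivity)
    rw [neg_div, neg_le_neg_iff, div_le_one (by positivity)]
    nlinarith
  calc _ = (Real.exp (-1) * (4 * Real.sqrt t)⁻¹) * (Real.exp (-2) * (2 * y / t)) := by
        rw [show (-3 : ℝ) = -1 + -2 by norm_num, Real.exp_add]; field_simp; norm_num
    _ ≤ _ := mul_le_mul h2 h1 (by positivity) (heat_nonneg _ _)

/-! ### The killed Gaussian walk with drift -/

/-- The probability that a Brownian bridge of duration `δ` from `x` to `y` stays positive. -/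
noncomputable def bridgeSurvival (δ x y : ℝ) : ℝ≥0∞ :=
  if 0 < x ∧ 0 < y then ENNReal.ofReal (1 - Real.exp (-(2 * x * y / δ))) else 0

theorem measurable_bridgeSurvival (δ : ℝ) :
    Measurable fun p : ℝ × ℝ => bridgeSurvival δ p.1 p.2 := by
  unfold bridgeSurvival
  refine Measurable.ite ?_ (by fun_prop) measurable_const
  exact (measurableSet_lt measurable_const measurable_fst).inter
    (measurableSet_lt measurable_const measurable_snd)

theorem bridgeSurvival_le_one (δ x y : ℝ) : bridgeSurvival δ x y ≤ 1 := by
  unfold bridgeSurvival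
  split_ifs
  · exact ENNReal.ofReal_le_one.2 (by linarith [Real.exp_pos (-(2 * x * y / δ))])
  · exact bot_le

/-- The transition operator of the Gaussian walk with drift `μ` per unit time and step variance
`δ`, killed when its Brownian interpolation hits the origin. -/
noncomputable def killedStep (δ μ : ℝ) (f : ℝ → ℝ≥0∞) (x : ℝ) : ℝ≥0∞ :=
  ∫⁻ z, bridgeSurvival δ x (x + μ * δ - z) * f (x + μ * δ - z) ∂(gaussianReal 0 δ.toNNReal)

theorem measurable_killedStep (δ μ : ℝ) {f : ℝ → ℝ≥0∞} (hf : Measurable f) :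
    Measurable (killedStep δ μ f) := by
  unfold killedStep
  refine Measurable.lintegral_prod_right' (f := fun p : ℝ × ℝ =>
    bridgeSurvival δ p.1 (p.1 + μ * δ - p.2) * f (p.1 + μ * δ - p.2)) ?_
  refine Measurable.mul ?_ (hf.comp (by fun_prop))
  exact (measurable_bridgeSurvival δ).comp (by fun_prop :
    Measurable fun p : ℝ × ℝ => (p.1, p.1 + μ * δ - p.2))

theorem measurable_killedStep_iterate (δ μ : ℝ) {f : ℝ → ℝ≥0∞} (hf : Measurable f) (k : ℕ) :
    Measurable ((killedStep δ μ)^[k] f) := by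
  induction k with
  | zero => exact hf
  | succ k ih => rw [Function.iterate_succ_apply']; exact measurable_killedStep _ _ ih

/-- Girsanov for one step: substituting y = x + μδ - z and expanding the square moves the drift into
an exponential factor. -/
theorem killedStep_eq {δ : ℝ} (hδ : 0 < δ) (μ : ℝ) {f : ℝ → ℝ≥0∞} (hf : Measurable f) {x : ℝ}
    (hx : 0 < x) :
    killedStep δ μ f x = ∫⁻ y in Set.Ioi 0,
      ENNReal.ofReal (Real.exp (-μ * (x - y) - μ ^ 2 * δ / 2) * killedHeat δ x y) * f y := by
  have hF : Measurable fun y => bridgeSurvival δ x y * f y :=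
    ((measurable_bridgeSurvival δ).comp (by fun_prop : Measurable fun y : ℝ => (x, y))).mul hf
  have hF' : Measurable fun z => bridgeSurvival δ x (x + μ * δ - z) * f (x + μ * δ - z) :=
    hF.comp (by fun_prop : Measurable fun z => x + μ * δ - z)
  unfold killedStep
  rw [gaussianReal_of_var_ne_zero _ (by simpa using hδ),
    lintegral_withDensity_eq_lintegral_mul _ (measurable_gaussianPDF _ _) hF',
    ← lintegral_sub_left_eq_self _ (x + μ * δ), ← lintegral_indicator measurableSet_Ioi]
  refine lintegral_congr fun y => ?_
  simp only [Pi.mul_apply, sub_sub_cancel, Set.indicator_apply, Set.mem_Ioi, bridgeSurvival, hx,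
    true_and]
  split_ifs with hy
  · rw [← mul_assoc, gaussianPDF, ← heat_eq_gaussianPDFReal hδ.le, ← ENNReal.ofReal_mul (heat_nonneg _ _),
      killedHeat_eq hδ]
    congr 2
    rw [← mul_assoc]
    congr 1
    unfold heat
    rw [mul_left_comm, ← Real.exp_add]
    congr 2
    field_simp; ring
  · simp

/-- The tilts telescope along the path and the killed kernels compose, so discretizing time costs
nothing. -/
theorem killedStep_iterate_eq {δ : ℝ} (hδ : 0 < δ) (μ : ℝ) {f : ℝ → ℝ≥0∞} (hf : Measurable f)
    (k : ℕ) {x : ℝ} (hx : 0 < x) :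
    (killedStep δ μ)^[k + 1] f x = ∫⁻ y in Set.Ioi 0,
      ENNReal.ofReal (Real.exp (-μ * (x - y) - μ ^ 2 * ((k + 1 : ℕ) * δ) / 2) *
        killedHeat ((k + 1 : ℕ) * δ) x y) * f y := by
  induction k generalizing x with
  | zero => simpa using killedStep_eq hδ μ hf hx
  | succ k ih =>
    rw [Function.iterate_succ_apply', killedStep_eq hδ μ (measurable_killedStep_iterate _ _ hf _) hx]
    have ht : (0 : ℝ) < (k + 1 : ℕ) * δ := by positivity
    calc _ = ∫⁻ y in Set.Ioi 0, ∫⁻ z in Set.Ioi 0,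
          ENNReal.ofReal (Real.exp (-μ * (x - z) - μ ^ 2 * ((k + 1 + 1 : ℕ) * δ) / 2)) * f z *
          (ENNReal.ofReal (killedHeat δ x y) * ENNReal.ofReal (killedHeat ((k + 1 : ℕ) * δ) y z)) := by
          refine setLIntegral_congr_fun measurableSet_Ioi fun y hy => ?_
          rw [ih hy, ← lintegral_const_mul]
          · refine setLIntegral_congr_fun measurableSet_Ioi fun z hz => ?_
            rw [ENNReal.ofReal_mul (Real.exp_pos _).le, ENNReal.ofReal_mul (Real.exp_pos _).le,
              show Real.exp (-μ * (x - z) - μ ^ 2 * ((k + 1 + 1 : ℕ) * δ) / 2) =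
                Real.exp (-μ * (x - y) - μ ^ 2 * δ / 2) *
                Real.exp (-μ * (y - z) - μ ^ 2 * ((k + 1 : ℕ) * δ) / 2) by
                rw [← Real.exp_add]; congr 1; push_cast; ring,
              ENNReal.ofReal_mul (Real.exp_pos _).le]
            ring
          · have := measurable_killedHeat ((k + 1 : ℕ) * δ) y
            fun_prop
      _ = ∫⁻ z in Set.Ioi 0, ∫⁻ y in Set.Ioi 0,
          ENNReal.ofReal (Real.exp (-μ * (x - z) - μ ^ 2 * ((k + 1 + 1 : ℕ) * δ) / 2)) * f z *
          (ENNReal.ofReal (killedHeat δ x y) * ENNReal.ofReal (killedHeat ((k + 1 : ℕ) * δ) y z)) := by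
          refine lintegral_lintegral_swap (Measurable.aemeasurable ?_)
          unfold killedHeat heat Function.uncurry
          fun_prop
      _ = _ := by
          refine setLIntegral_congr_fun measurableSet_Ioi fun z hz => ?_
          rw [lintegral_const_mul, lintegral_killedHeat_mul hδ ht hx hz, ENNReal.ofReal_mul (Real.exp_pos _).le]
          · rw [show δ + (k + 1 : ℕ) * δ = (k + 1 + 1 : ℕ) * δ by push_cast; ring]; ring
          · have := measurable_killedHeat δ x
            have := measurable_killedHeat_left ((k + 1 : ℕ) * δ) z
            fun_prop

/-- The indicator function of `(0, 1]`. -/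
noncomputable def unitTarget : ℝ → ℝ≥0∞ := (Set.Ioc (0 : ℝ) 1).indicator 1

theorem measurable_unitTarget : Measurable unitTarget :=
  measurable_one.indicator measurableSet_Ioc

theorem unitTarget_sq (x : ℝ) : unitTarget x ^ 2 = unitTarget x := by
  unfold unitTarget Set.indicator
  split_ifs <;> simp

theorem killedStep_iterate_unitTarget {δ : ℝ} (hδ : 0 < δ) (μ : ℝ) (k : ℕ) {x : ℝ} (hx : 0 < x) :
    (killedStep δ μ)^[k + 1] unitTarget x = ∫⁻ y in Set.Ioc 0 1,
      ENNReal.ofReal (Real.exp (-μ * (x - y) - μ ^ 2 * ((k + 1 : ℕ) * δ) / 2) *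
        killedHeat ((k + 1 : ℕ) * δ) x y) := by
  rw [killedStep_iterate_eq hδ μ measurable_unitTarget k hx, ← lintegral_indicator measurableSet_Ioi,
    ← lintegral_indicator measurableSet_Ioc]
  refine lintegral_congr fun y => ?_
  by_cases h : y ∈ Set.Ioc (0 : ℝ) 1
  · have : y ∈ Set.Ioi (0 : ℝ) := h.1
    simp [unitTarget, h, this]
  · rw [Set.indicator_of_notMem h]
    have h0 : unitTarget y = 0 := Set.indicator_of_notMem h _
    simp [h0, Set.indicator_apply]

theorem killedStep_iterate_unitTarget_le {δ : ℝ} (hδ : 0 < δ) {μ : ℝ} (hμ : 0 ≤ μ) (k : ℕ) {x : ℝ}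
    (hx : 0 < x) :
    (killedStep δ μ)^[k + 1] unitTarget x ≤
      ENNReal.ofReal (Real.exp (-μ * x - μ ^ 2 * ((k + 1 : ℕ) * δ) / 2) * x *
        (Real.sqrt ((k + 1 : ℕ) * δ) * ((k + 1 : ℕ) * δ))⁻¹ * Real.exp μ) := by
  rw [killedStep_iterate_unitTarget hδ μ k hx]
  have ht : (0 : ℝ) < (k + 1 : ℕ) * δ := by positivity
  set t : ℝ := (k + 1 : ℕ) * δ
  calc _ ≤ ∫⁻ y in Set.Ioc (0 : ℝ) 1, ENNReal.ofReal (Real.exp (-μ * x - μ ^ 2 * t / 2) * x *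
        (Real.sqrt t * t)⁻¹ * Real.exp μ) := by
        refine setLIntegral_mono measurable_const fun y hy => ENNReal.ofReal_le_ofReal ?_
        have h1 := killedHeat_le ht hx hy.1
        have h2 : Real.exp (-μ * (x - y) - μ ^ 2 * t / 2) ≤
            Real.exp (-μ * x - μ ^ 2 * t / 2) * Real.exp μ := by
          rw [← Real.exp_add]
          exact Real.exp_le_exp.2 (by nlinarith [hy.2])
        have h3 : x * y * (Real.sqrt t * t)⁻¹ ≤ x * 1 * (Real.sqrt t * t)⁻¹ := by
          gcongr; exact hy.2
        calc _ ≤ (Real.exp (-μ * x - μ ^ 2 * t / 2) * Real.exp μ) * (x * 1 * (Real.sqrt t * t)⁻¹) :=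
              mul_le_mul h2 (h1.trans h3) (killedHeat_nonneg ht hx hy.1) (by positivity)
          _ = _ := by ring
    _ = _ := by simp

theorem le_killedStep_iterate_unitTarget {δ : ℝ} (hδ : 0 < δ) {μ : ℝ} (hμ : 0 ≤ μ) (k : ℕ)
    (hk : 1 ≤ (k + 1 : ℕ) * δ) :
    ENNReal.ofReal (Real.exp (-μ - μ ^ 2 * ((k + 1 : ℕ) * δ) / 2) *
        (Real.sqrt ((k + 1 : ℕ) * δ) * ((k + 1 : ℕ) * δ))⁻¹ * (Real.exp (-3) / 8)) ≤
      (killedStep δ μ)^[k + 1] unitTarget 1 := by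
  rw [killedStep_iterate_unitTarget hδ μ k one_pos]
  set t : ℝ := (k + 1 : ℕ) * δ
  calc _ = ∫⁻ y in Set.Ioc (1 / 2 : ℝ) 1, ENNReal.ofReal (Real.exp (-μ - μ ^ 2 * t / 2) *
        (Real.sqrt t * t)⁻¹ * (Real.exp (-3) / 4)) := by
        rw [setLIntegral_const, Real.volume_Ioc, ← ENNReal.ofReal_mul (by positivity)]
        congr 1; ring
    _ ≤ ∫⁻ y in Set.Ioc (1 / 2 : ℝ) 1,
          ENNReal.ofReal (Real.exp (-μ * (1 - y) - μ ^ 2 * t / 2) * killedHeat t 1 y) := by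
        refine setLIntegral_mono (by have := measurable_killedHeat t 1; fun_prop) fun y hy =>
          ENNReal.ofReal_le_ofReal ?_
        have hy0 : 0 < y := by linarith [hy.1]
        have h1 := le_killedHeat_one hk hy0 hy.2
        have h2 : Real.exp (-μ - μ ^ 2 * t / 2) ≤ Real.exp (-μ * (1 - y) - μ ^ 2 * t / 2) :=
          Real.exp_le_exp.2 (by nlinarith)
        have h3 : Real.exp (-3) / 2 * (1 / 2) * (Real.sqrt t * t)⁻¹ ≤
            Real.exp (-3) / 2 * y * (Real.sqrt t * t)⁻¹ := by
          gcongr; exact hy.1.le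
        calc _ = Real.exp (-μ - μ ^ 2 * t / 2) *
              (Real.exp (-3) / 2 * (1 / 2) * (Real.sqrt t * t)⁻¹) := by ring
          _ ≤ _ := mul_le_mul h2 (h3.trans h1) (by positivity) (by positivity)
    _ ≤ _ := lintegral_mono_set (Set.Ioc_subset_Ioc_left (by norm_num))

theorem lintegral_cube_mul_exp {μ : ℝ} (hμ : 0 < μ) :
    ∫⁻ y in Set.Ioi (0 : ℝ), ENNReal.ofReal (y ^ 3 * Real.exp (-(μ * y))) =
      ENNReal.ofReal (6 / μ ^ 4) := by
  have h := Real.integral_rpow_mul_exp_neg_mul_Ioi (a := 4) (by norm_num) hμ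
  have e : ∀ y : ℝ, y ^ ((4 : ℝ) - 1) * Real.exp (-(μ * y)) = y ^ 3 * Real.exp (-(μ * y)) := by
    intro y
    rw [show (4 : ℝ) - 1 = (3 : ℕ) by norm_num, Real.rpow_natCast]
  simp_rw [e] at h
  have hG : Real.Gamma 4 = 6 := by
    have h4 := Real.Gamma_nat_eq_factorial 3
    rw [show ((3 : ℕ) : ℝ) + 1 = 4 by norm_num] at h4
    rw [h4]; norm_num [Nat.factorial]
  have hval : (1 / μ) ^ (4 : ℝ) * Real.Gamma 4 = 6 / μ ^ 4 := by
    rw [hG, show (4 : ℝ) = (4 : ℕ) by norm_num, Real.rpow_natCast]; field_simp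
  rw [← hval, ← h, ofReal_integral_eq_lintegral_ofReal]
  · by_contra hni
    rw [integral_undef hni, hval] at h
    have : 0 < 6 / μ ^ 4 := by positivity
    linarith
  · refine (ae_restrict_iff' measurableSet_Ioi).2 (.of_forall fun y hy => ?_)
    have : (0 : ℝ) < y := hy
    simp only [Pi.zero_apply]
    positivity

/-- At the split the walk sits at distance y from the barrier. The common part contributes y e^{μy}
and the two branches contribute (y e^{-μy})², so y³ e^{-μy} remains and its integral is finite. -/
theorem killedStep_iterate_sq_le {δ : ℝ} (hδ : 0 < δ) {μ : ℝ} (hμ : 0 < μ) (k l : ℕ) :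
    (killedStep δ μ)^[k + 1] (fun x => ((killedStep δ μ)^[l + 1] unitTarget x) ^ 2) 1 ≤
      ENNReal.ofReal (Real.exp (-(μ ^ 2 * ((k + 1 : ℕ) * δ + 2 * ((l + 1 : ℕ) * δ)) / 2)) *
        (Real.sqrt ((k + 1 : ℕ) * δ) * ((k + 1 : ℕ) * δ))⁻¹ *
        ((Real.sqrt ((l + 1 : ℕ) * δ) * ((l + 1 : ℕ) * δ))⁻¹) ^ 2 * Real.exp (2 * μ) *
          (6 / μ ^ 4)) := by
  have hs : (0 : ℝ) < (k + 1 : ℕ) * δ := by positivity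
  have hr : (0 : ℝ) < (l + 1 : ℕ) * δ := by positivity
  have hB := fun y (hy : 0 < y) => killedStep_iterate_unitTarget_le hδ hμ.le l hy
  rw [killedStep_iterate_eq hδ μ
    ((measurable_killedStep_iterate _ _ measurable_unitTarget _).pow_const 2) k one_pos]
  set s : ℝ := (k + 1 : ℕ) * δ
  set r : ℝ := (l + 1 : ℕ) * δ
  set A : ℝ := Real.exp (-(μ ^ 2 * (s + 2 * r) / 2)) *
        (Real.sqrt s * s)⁻¹ * ((Real.sqrt r * r)⁻¹) ^ 2 * Real.exp (2 * μ) with hA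
  calc _ ≤ ∫⁻ y in Set.Ioi (0 : ℝ), ENNReal.ofReal A *
        ENNReal.ofReal (y ^ 3 * Real.exp (-(μ * y))) := by
        refine setLIntegral_mono (by fun_prop) fun y hy => ?_
        have hy0 : (0 : ℝ) < y := hy
        refine (mul_le_mul_right (pow_le_pow_left₀ bot_le (hB y hy) 2) _).trans ?_
        have hk0 := killedHeat_nonneg hs one_pos hy0
        rw [← ENNReal.ofReal_pow (by positivity), ← ENNReal.ofReal_mul (by positivity),
          ← ENNReal.ofReal_mul (by positivity)]
        refine ENNReal.ofReal_le_ofReal ?_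
        have h1 := killedHeat_le hs one_pos hy0
        calc _ ≤ (Real.exp (-μ * (1 - y) - μ ^ 2 * s / 2) * (1 * y * (Real.sqrt s * s)⁻¹)) *
              (Real.exp (-μ * y - μ ^ 2 * r / 2) * y * (Real.sqrt r * r)⁻¹ * Real.exp μ) ^ 2 := by
              gcongr
          _ = (Real.exp (-μ * (1 - y) - μ ^ 2 * s / 2) * Real.exp (-μ * y - μ ^ 2 * r / 2) ^ 2 *
                Real.exp μ ^ 2) *
              ((Real.sqrt s * s)⁻¹ * ((Real.sqrt r * r)⁻¹) ^ 2 * y ^ 3) := by ring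
          _ ≤ (Real.exp (-(μ ^ 2 * (s + 2 * r) / 2)) * Real.exp (2 * μ) * Real.exp (-(μ * y))) *
              ((Real.sqrt s * s)⁻¹ * ((Real.sqrt r * r)⁻¹) ^ 2 * y ^ 3) := by
              refine mul_le_mul_of_nonneg_right ?_ (by positivity)
              rw [← Real.exp_nat_mul, ← Real.exp_nat_mul, ← Real.exp_add, ← Real.exp_add,
                ← Real.exp_add, ← Real.exp_add]
              refine Real.exp_le_exp.2 ?_
              push_cast
              nlinarith
          _ = _ := by rw [hA]; ring
    _ = _ := by
        rw [lintegral_const_mul _ (by fun_prop), lintegral_cube_mul_exp hμ,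
          ← ENNReal.ofReal_mul (by positivity)]

/-! ### Estimates for the centering and the sum over split times -/

/-- The typical height of the maximum at time `T`. -/
noncomputable def maxHeight (d : ℕ) (T : ℝ) : ℝ :=
  Real.sqrt (2 * d) * T - (3 / 2) / Real.sqrt (2 * d) * Real.log T

theorem log_le_half {T : ℝ} (hT : 0 < T) : Real.log T ≤ T / 2 := by
  have h1 := Real.log_le_sub_one_of_pos (show 0 < T / 2 by positivity)
  rw [Real.log_div hT.ne' (by norm_num)] at h1
  have := Real.log_two_lt_d9
  linarith

theorem log_sq_le {T : ℝ} (hT : 1 ≤ T) : Real.log T ^ 2 ≤ T := by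
  have hT0 : 0 < T := by linarith
  have h0 : 0 ≤ Real.log T := Real.log_nonneg hT
  have h1 := log_le_half (show 0 < Real.sqrt T by positivity)
  rw [Real.log_sqrt hT0.le] at h1
  have h2 : Real.log T ≤ Real.sqrt T := by linarith
  calc _ ≤ Real.sqrt T ^ 2 := by gcongr
    _ = T := Real.sq_sqrt hT0.le

section
variable {d : ℕ} (hd : 1 ≤ d) {T : ℝ} (hT : 1 ≤ T)
include hd hT

theorem maxHeight_div_le : maxHeight d T / T ≤ Real.sqrt (2 * d) := by
  have : 0 ≤ Real.log T := Real.log_nonneg hT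
  rw [div_le_iff₀ (by linarith)]
  unfold maxHeight
  have : 0 ≤ (3 / 2) / Real.sqrt (2 * d) * Real.log T := by positivity
  linarith

/-- Keeps the slope away from zero, so that 6/μ⁴ in the second moment stays bounded uniformly in T.
-/
theorem le_maxHeight_div : Real.sqrt (2 * d) / 4 ≤ maxHeight d T / T := by
  have hd' : (1 : ℝ) ≤ d := by exact_mod_cast hd
  have h := log_le_half (show 0 < T by linarith)
  rw [le_div_iff₀ (by linarith)]
  unfold maxHeight
  have hb : 0 < Real.sqrt (2 * d) := by positivity
  have hb2 : Real.sqrt (2 * d) ^ 2 = 2 * d := Real.sq_sqrt (by positivity)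
  set b := Real.sqrt (2 * d)
  have h1 : (3 / 2) / b ≤ 3 / 4 * b := by
    rw [div_le_iff₀ hb]; nlinarith
  have h2 : (3 / 2) / b * Real.log T ≤ 3 / 4 * b * T := by
    calc _ ≤ (3 / 2) / b * (T / 2) := by gcongr
      _ ≤ 3 / 4 * b * (T / 2) := by gcongr
      _ ≤ _ := by nlinarith [mul_pos hb (show 0 < T by linarith)]
  linarith

/-- The cross term of the square gives -(3/2) log T, hence a factor T^{3/2} after exponentiation.
The last term is bounded because log² T ≤ T. -/
theorem sq_maxHeight_div : (maxHeight d T / T) ^ 2 * T / 2 =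
    d * T - 3 / 2 * Real.log T + 9 / (16 * d) * (Real.log T ^ 2 / T) := by
  have hd' : (1 : ℝ) ≤ d := by exact_mod_cast hd
  unfold maxHeight
  have hb : 0 < Real.sqrt (2 * d) := by positivity
  have hb2 : Real.sqrt (2 * d) ^ 2 = 2 * d := Real.sq_sqrt (by positivity)
  have hd2 : (d : ℝ) = Real.sqrt (2 * d) ^ 2 / 2 := by linarith
  set b := Real.sqrt (2 * d)
  rw [hd2]
  have : T ≠ 0 := by linarith
  field_simp
  ring

theorem exp_neg_sq_maxHeight_div_le : Real.exp (-((maxHeight d T / T) ^ 2 * T / 2)) ≤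
    Real.exp (-(d * T)) * T ^ (3 / 2 : ℝ) := by
  rw [sq_maxHeight_div hd hT, Real.rpow_def_of_pos (by linarith), ← Real.exp_add]
  refine Real.exp_le_exp.2 ?_
  have : 0 ≤ 9 / (16 * d) * (Real.log T ^ 2 / T) := by positivity
  linarith

theorem le_exp_neg_sq_maxHeight_div : Real.exp (-1) * (Real.exp (-(d * T)) * T ^ (3 / 2 : ℝ)) ≤
    Real.exp (-((maxHeight d T / T) ^ 2 * T / 2)) := by
  rw [sq_maxHeight_div hd hT, Real.rpow_def_of_pos (by linarith), ← Real.exp_add, ← Real.exp_add]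
  refine Real.exp_le_exp.2 ?_
  have hd' : (1 : ℝ) ≤ d := by exact_mod_cast hd
  have h1 : Real.log T ^ 2 / T ≤ 1 := by
    rw [div_le_one (by linarith)]; exact log_sq_le hT
  have h2 : 9 / (16 * (d : ℝ)) ≤ 1 := by
    rw [div_le_one (by positivity)]; linarith
  have : 9 / (16 * d) * (Real.log T ^ 2 / T) ≤ 1 * 1 := by gcongr
  linarith

end

theorem sqrt_mul_self_inv {t : ℝ} (ht : 0 < t) : (Real.sqrt t * t)⁻¹ = t ^ (-(3 / 2) : ℝ) := by
  rw [Real.rpow_neg ht.le, Real.sqrt_eq_rpow]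
  congr 1
  nth_rw 2 [← Real.rpow_one t]
  rw [← Real.rpow_add ht]; norm_num

/-- Weighted AM–GM for T and 1. It absorbs the excess power of T when the tilt acts over total time
T + r. -/
theorem rpow_le_one_add {T r : ℝ} (hT : 0 < T) (hr : 0 ≤ r) (hrT : r ≤ T) : T ^ (r / T) ≤ 1 + r := by
  have h := Real.geom_mean_le_arith_mean2_weighted (w₁ := r / T) (w₂ := 1 - r / T) (p₁ := T)
    (p₂ := 1) (by positivity) (by rw [sub_nonneg, div_le_one hT]; exact hrT) hT.le zero_le_one (by ring)
  rw [Real.one_rpow, mul_one] at h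
  have : r / T * T = r := by field_simp
  have : 0 ≤ r / T := by positivity
  linarith

theorem three_halves_rpow_le {δ : ℝ} (hδ : 1 / 2 ≤ δ) (k l : ℕ) :
    ((((k + 1 : ℕ) * δ + (l + 1 : ℕ) * δ) * (1 + (l + 1 : ℕ) * δ)) ^ (3 / 2 : ℝ)) *
      ((k + 1 : ℕ) * δ) ^ (-(3 / 2) : ℝ) * (((l + 1 : ℕ) * δ) ^ (-(3 / 2) : ℝ)) ^ 2 ≤
    12 ^ (3 / 2 : ℝ) * (((k + 1 : ℕ) : ℝ) ^ (-(3 / 2) : ℝ) + ((l + 1 : ℕ) : ℝ) ^ (-(3 / 2) : ℝ)) := by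
  have hδ0 : 0 < δ := by linarith
  have hk : (1 : ℝ) ≤ (k + 1 : ℕ) := by exact_mod_cast Nat.succ_pos k
  have hl : (1 : ℝ) ≤ (l + 1 : ℕ) := by exact_mod_cast Nat.succ_pos l
  generalize ((k + 1 : ℕ) : ℝ) = a at *
  generalize ((l + 1 : ℕ) : ℝ) = b at *
  have ha0 : 0 < a := by linarith
  have hb0 : 0 < b := by linarith
  rw [Real.rpow_neg (by positivity), Real.rpow_neg (by positivity), Real.rpow_neg (by positivity),
    Real.rpow_neg (by positivity), ← Real.inv_rpow (by positivity), ← Real.inv_rpow (by positivity),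
    ← Real.inv_rpow (by positivity), ← Real.inv_rpow (by positivity), sq,
    ← Real.mul_rpow (by positivity) (by positivity), ← Real.mul_rpow (by positivity) (by positivity),
    ← Real.mul_rpow (by positivity) (by positivity)]
  -- Since δ ≥ 1/2 and b ≥ 1, the factor 1 + bδ is at most 3bδ. The 12 below comes from 6(u + v) ≤
  -- 12 max(u, v).
  have hbase : (a * δ + b * δ) * (1 + b * δ) * (a * δ)⁻¹ * ((b * δ)⁻¹ * (b * δ)⁻¹) ≤
      6 * (a⁻¹ + b⁻¹) := by
    have h1 : 1 + b * δ ≤ 3 * (b * δ) := by nlinarith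
    calc _ ≤ (a * δ + b * δ) * (3 * (b * δ)) * (a * δ)⁻¹ * ((b * δ)⁻¹ * (b * δ)⁻¹) := by gcongr
      _ = 3 * (a⁻¹ + b⁻¹) * δ⁻¹ := by field_simp; ring
      _ ≤ 3 * (a⁻¹ + b⁻¹) * 2 := by
        gcongr
        rw [inv_le_comm₀ hδ0 (by norm_num)]; linarith
      _ = _ := by ring
  have key : ∀ u v : ℝ, 0 < u → 0 < v → u ≤ v →
      (6 * (u + v)) ^ (3 / 2 : ℝ) ≤ 12 ^ (3 / 2 : ℝ) * (u ^ (3 / 2 : ℝ) + v ^ (3 / 2 : ℝ)) := by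
    intro u v hu hv huv
    calc _ ≤ (12 * v) ^ (3 / 2 : ℝ) := Real.rpow_le_rpow (by positivity) (by linarith) (by norm_num)
      _ = 12 ^ (3 / 2 : ℝ) * v ^ (3 / 2 : ℝ) := Real.mul_rpow (by norm_num) hv.le
      _ ≤ _ := by
        gcongr
        have : 0 ≤ u ^ (3 / 2 : ℝ) := by positivity
        linarith
  refine (Real.rpow_le_rpow (by positivity) hbase (by norm_num)).trans ?_
  rcases le_total a⁻¹ b⁻¹ with h | h
  · exact key _ _ (by positivity) (by positivity) h
  · rw [add_comm a⁻¹, add_comm (a⁻¹ ^ _)]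
    exact key _ _ (by positivity) (by positivity) h

/-- The summable profile of the second moment over split times. -/
noncomputable def splitWeight (n k : ℕ) : ℝ :=
  -- Since `0 ^ (-(3/2))` is 0 for `Real.rpow`, the indicators supply the weight at the two
  -- endpoints.
  (if k = 0 then 1 else 0) + (if k = n then 1 else 0) +
    (k : ℝ) ^ (-(3 / 2) : ℝ) + ((n - k : ℕ) : ℝ) ^ (-(3 / 2) : ℝ)

theorem splitWeight_nonneg (n k : ℕ) : 0 ≤ splitWeight n k := by
  unfold splitWeight; positivity

theorem exists_sum_splitWeight_le :
    ∃ W : ℝ, 0 < W ∧ ∀ n, ∑ k ∈ Finset.range (n + 1), splitWeight n k ≤ W := by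
  have hs : Summable fun k : ℕ => (k : ℝ) ^ (-(3 / 2) : ℝ) :=
    Real.summable_nat_rpow.2 (by norm_num)
  refine ⟨2 + 2 * ∑' k : ℕ, (k : ℝ) ^ (-(3 / 2) : ℝ), ?_, fun n => ?_⟩
  · have : 0 ≤ ∑' k : ℕ, (k : ℝ) ^ (-(3 / 2) : ℝ) := tsum_nonneg fun k => by positivity
    linarith
  · unfold splitWeight
    rw [Finset.sum_add_distrib, Finset.sum_add_distrib, Finset.sum_add_distrib]
    have h1 : ∑ k ∈ Finset.range (n + 1), (k : ℝ) ^ (-(3 / 2) : ℝ) ≤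
        ∑' k : ℕ, (k : ℝ) ^ (-(3 / 2) : ℝ) :=
      hs.sum_le_tsum _ fun k _ => by positivity
    have h2 : ∑ k ∈ Finset.range (n + 1), ((n - k : ℕ) : ℝ) ^ (-(3 / 2) : ℝ) =
        ∑ k ∈ Finset.range (n + 1), (k : ℝ) ^ (-(3 / 2) : ℝ) := by
      rw [← Finset.sum_range_reflect]
      refine Finset.sum_congr rfl fun k hk => ?_
      rw [Finset.mem_range] at hk
      congr 3; omega
    have h3 : ∑ k ∈ Finset.range (n + 1), (if k = 0 then (1 : ℝ) else 0) = 1 := by simp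
    have h4 : ∑ k ∈ Finset.range (n + 1), (if k = n then (1 : ℝ) else 0) = 1 := by simp
    rw [h2, h3, h4]; linarith

/-! ### One-walk bounds for the first and second moments -/

theorem exists_le_killedStep_iterate {d : ℕ} (hd : 1 ≤ d) :
    ∃ c : ℝ, 0 < c ∧ ∀ (n : ℕ) (δ : ℝ), 0 < δ → 1 ≤ n * δ →
      ENNReal.ofReal (c * Real.exp (-(d * (n * δ)))) ≤
        (killedStep δ (maxHeight d (n * δ) / (n * δ)))^[n] unitTarget 1 := by
  refine ⟨Real.exp (-Real.sqrt (2 * d)) * Real.exp (-1) * (Real.exp (-3) / 8), by positivity,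
    fun n δ hδ hT => ?_⟩
  rcases n with _ | k
  · norm_num at hT
  have hT0 : 0 < (k + 1 : ℕ) * δ := by linarith
  have hub := maxHeight_div_le hd hT
  have hlb := (show (0 : ℝ) ≤ Real.sqrt (2 * d) / 4 by positivity).trans (le_maxHeight_div hd hT)
  refine le_trans (ENNReal.ofReal_le_ofReal ?_) (le_killedStep_iterate_unitTarget hδ hlb k hT)
  have hle := le_exp_neg_sq_maxHeight_div hd hT
  rw [sqrt_mul_self_inv hT0]
  set T : ℝ := (k + 1 : ℕ) * δ
  set μ := maxHeight d T / T
  have hTT : T ^ (3 / 2 : ℝ) * T ^ (-(3 / 2) : ℝ) = 1 := by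
    rw [← Real.rpow_add hT0]; norm_num
  calc _ = Real.exp (-Real.sqrt (2 * d)) * (Real.exp (-1) * (Real.exp (-(d * T)) * T ^ (3 / 2 : ℝ)))
        * T ^ (-(3 / 2) : ℝ) * (Real.exp (-3) / 8) := by
        rw [mul_assoc _ _ (T ^ (-(3 / 2) : ℝ)), mul_assoc (Real.exp (-1)), mul_assoc _ _ (T ^ (-(3 / 2) : ℝ)),
          hTT]
        ring
    _ ≤ Real.exp (-μ) * Real.exp (-(μ ^ 2 * T / 2)) * T ^ (-(3 / 2) : ℝ) * (Real.exp (-3) / 8) := by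
        gcongr
    _ = _ := by rw [← Real.exp_add, ← sub_eq_add_neg]

theorem exists_killedStep_iterate_sq_le {d : ℕ} (hd : 1 ≤ d) :
    ∃ C : ℝ, 0 < C ∧ ∀ (n : ℕ) (δ : ℝ), 1 / 2 ≤ δ → 1 ≤ n * δ → ∀ k ≤ n,
      (killedStep δ (maxHeight d (n * δ) / (n * δ)))^[k] (fun x =>
        ((killedStep δ (maxHeight d (n * δ) / (n * δ)))^[n - k] unitTarget x) ^ 2) 1 ≤
      ENNReal.ofReal (C * Real.exp (-(d * (n * δ + (n - k : ℕ) * δ))) * splitWeight n k) := by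
  set b := Real.sqrt (2 * d) with hb
  have hd' : (1 : ℝ) ≤ d := by exact_mod_cast hd
  have hb0 : 0 < b := by positivity
  -- Dominates the constants of all three cases: e^b for k = n, e^{2b} for k = 0, and the interior
  -- constant, obtained from b/4 ≤ μ ≤ b.
  set C1 := Real.exp (2 * b) * (1 + 12 ^ (3 / 2 : ℝ) * (6 / (b / 4) ^ 4)) with hC1
  have hC1a : Real.exp b ≤ C1 := by
    have h1 : Real.exp b ≤ Real.exp (2 * b) := Real.exp_le_exp.2 (by linarith)
    have h2 : 0 ≤ Real.exp (2 * b) * (12 ^ (3 / 2 : ℝ) * (6 / (b / 4) ^ 4)) := by positivity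
    rw [hC1]; linarith
  have hC1b : Real.exp b ^ 2 ≤ C1 := by
    have h2 : 0 ≤ Real.exp (2 * b) * (12 ^ (3 / 2 : ℝ) * (6 / (b / 4) ^ 4)) := by positivity
    rw [hC1, ← Real.exp_nat_mul]; push_cast; linarith
  have hC1c : Real.exp (2 * b) * (12 ^ (3 / 2 : ℝ) * (6 / (b / 4) ^ 4)) ≤ C1 := by
    have := Real.exp_pos (2 * b)
    rw [hC1]; linarith
  have hC10 : 0 < C1 := (Real.exp_pos b).trans_le hC1a
  refine ⟨C1, hC10, fun n δ hδ hT k hk => ?_⟩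
  have hδ0 : 0 < δ := by linarith
  have hT0 : 0 < n * δ := by linarith
  have hub := maxHeight_div_le hd hT
  have hlb := le_maxHeight_div hd hT
  have hle := exp_neg_sq_maxHeight_div_le hd hT
  have hTT : (n * δ) ^ (3 / 2 : ℝ) * (n * δ) ^ (-(3 / 2) : ℝ) = 1 := by
    rw [← Real.rpow_add hT0]; norm_num
  set μ := maxHeight d (n * δ) / (n * δ) with hμdef
  have hμ0 : 0 < μ := lt_of_lt_of_le (by positivity) hlb
  have hfirst : (killedStep δ μ)^[n] unitTarget 1 ≤
      ENNReal.ofReal (Real.exp b * Real.exp (-(d * (n * δ)))) := by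
    rcases n with _ | m
    · norm_num at hT
    refine (killedStep_iterate_unitTarget_le hδ0 hμ0.le m one_pos).trans
      (ENNReal.ofReal_le_ofReal ?_)
    rw [sqrt_mul_self_inv hT0]
    set T : ℝ := (m + 1 : ℕ) * δ
    calc _ = Real.exp (-(μ ^ 2 * T / 2)) * T ^ (-(3 / 2) : ℝ) := by
          have : Real.exp (-μ * 1 - μ ^ 2 * T / 2) * Real.exp μ = Real.exp (-(μ ^ 2 * T / 2)) := by
            rw [← Real.exp_add]; congr 1; ring
          rw [← this]; ring
      _ ≤ (Real.exp (-(d * T)) * T ^ (3 / 2 : ℝ)) * T ^ (-(3 / 2) : ℝ) := by gcongr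
      _ = 1 * Real.exp (-(d * T)) := by rw [mul_assoc, hTT]; ring
      _ ≤ _ := by
        gcongr
        exact Real.one_le_exp hb0.le
  rcases k with _ | k
  · have hn : n ≠ 0 := by rintro rfl; norm_num at hT
    have hw : 1 ≤ splitWeight n 0 := by
      unfold splitWeight
      have : (0 : ℝ) ≤ if 0 = n then 1 else 0 := by positivity
      have : (0 : ℝ) ≤ ((0 : ℕ) : ℝ) ^ (-(3 / 2) : ℝ) := by positivity
      have : (0 : ℝ) ≤ ((n - 0 : ℕ) : ℝ) ^ (-(3 / 2) : ℝ) := by positivity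
      simp only [if_true]; linarith
    simp only [Function.iterate_zero, id, Nat.sub_zero]
    refine (pow_le_pow_left₀ bot_le hfirst 2).trans ?_
    rw [← ENNReal.ofReal_pow (by positivity)]
    refine ENNReal.ofReal_le_ofReal ?_
    calc _ = Real.exp b ^ 2 * Real.exp (-(d * (n * δ + n * δ))) * 1 := by
          rw [mul_pow, ← Real.exp_nat_mul (-(d * (n * δ))) 2]
          rw [mul_one]; congr 2; push_cast; ring
      _ ≤ _ := by gcongr
  rcases hk.eq_or_lt with hkn | hkn
  · have hw : 1 ≤ splitWeight n n := by
      unfold splitWeight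
      have : (0 : ℝ) ≤ if n = 0 then 1 else 0 := by positivity
      have : (0 : ℝ) ≤ (n : ℝ) ^ (-(3 / 2) : ℝ) := by positivity
      have : (0 : ℝ) ≤ ((n - n : ℕ) : ℝ) ^ (-(3 / 2) : ℝ) := by positivity
      simp only [if_true]; linarith
    rw [hkn]
    simp only [Nat.sub_self, Function.iterate_zero, id, unitTarget_sq]
    refine hfirst.trans (ENNReal.ofReal_le_ofReal ?_)
    calc _ = Real.exp b * Real.exp (-(d * (n * δ + (0 : ℕ) * δ))) * 1 := by simp
      _ ≤ _ := by gcongr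
  · obtain ⟨l, rfl⟩ : ∃ l, n = (k + 1) + (l + 1) := ⟨n - (k + 1) - 1, by omega⟩
    have hsub : k + 1 + (l + 1) - (k + 1) = l + 1 := by omega
    rw [hsub]
    refine (killedStep_iterate_sq_le hδ0 hμ0 k l).trans (ENNReal.ofReal_le_ofReal ?_)
    have hs : (0 : ℝ) < (k + 1 : ℕ) * δ := by positivity
    have hr : (0 : ℝ) < (l + 1 : ℕ) * δ := by positivity
    rw [sqrt_mul_self_inv hs, sqrt_mul_self_inv hr]
    have hnum := three_halves_rpow_le hδ k l
    have hw : ((k + 1 : ℕ) : ℝ) ^ (-(3 / 2) : ℝ) + ((l + 1 : ℕ) : ℝ) ^ (-(3 / 2) : ℝ) ≤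
        splitWeight (k + 1 + (l + 1)) (k + 1) := by
      unfold splitWeight
      rw [hsub]
      have : (0 : ℝ) ≤ if k + 1 = 0 then 1 else 0 := by positivity
      have : (0 : ℝ) ≤ if k + 1 = k + 1 + (l + 1) then 1 else 0 := by positivity
      linarith
    have hTsr : ((k + 1 + (l + 1) : ℕ) : ℝ) * δ = (k + 1 : ℕ) * δ + (l + 1 : ℕ) * δ := by
      push_cast; ring
    rw [hTsr] at hle hT0 hT ⊢
    set s : ℝ := (k + 1 : ℕ) * δ
    set r : ℝ := (l + 1 : ℕ) * δ
    -- With T = s + r the total duration s + 2r equals T(1 + r/T), so the bound at time T is raised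
    -- to the power 1 + r/T.
    have hexp : Real.exp (-(μ ^ 2 * (s + 2 * r) / 2)) ≤
        Real.exp (-(d * (s + r + r))) * ((s + r) * (1 + r)) ^ (3 / 2 : ℝ) := by
      have hT0' : s + r ≠ 0 := hT0.ne'
      calc _ = Real.exp (-(μ ^ 2 * (s + r) / 2)) ^ (1 + r / (s + r)) := by
            rw [← Real.exp_mul]; congr 1; field_simp; ring
        _ ≤ (Real.exp (-(d * (s + r))) * (s + r) ^ (3 / 2 : ℝ)) ^ (1 + r / (s + r)) :=
            Real.rpow_le_rpow (Real.exp_pos _).le hle (by positivity)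
        _ = Real.exp (-(d * (s + r + r))) * ((s + r) * (s + r) ^ (r / (s + r))) ^ (3 / 2 : ℝ) := by
            rw [Real.mul_rpow (Real.exp_pos _).le (by positivity), ← Real.exp_mul,
              ← Real.rpow_mul hT0.le, mul_comm (3 / 2 : ℝ), Real.rpow_mul hT0.le,
              Real.rpow_add hT0, Real.rpow_one]
            congr 2; field_simp
        _ ≤ _ := by
            gcongr
            exact rpow_le_one_add hT0 hr.le (by linarith)
    calc _ ≤ (Real.exp (-(d * (s + r + r))) * ((s + r) * (1 + r)) ^ (3 / 2 : ℝ)) *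
          s ^ (-(3 / 2) : ℝ) * (r ^ (-(3 / 2) : ℝ)) ^ 2 * Real.exp (2 * b) * (6 / (b / 4) ^ 4) := by
          gcongr
      _ = Real.exp (-(d * (s + r + r))) * Real.exp (2 * b) * (6 / (b / 4) ^ 4) *
          (((s + r) * (1 + r)) ^ (3 / 2 : ℝ) * s ^ (-(3 / 2) : ℝ) * (r ^ (-(3 / 2) : ℝ)) ^ 2) := by
          ring
      _ ≤ Real.exp (-(d * (s + r + r))) * Real.exp (2 * b) * (6 / (b / 4) ^ 4) *
          (12 ^ (3 / 2 : ℝ) * splitWeight (k + 1 + (l + 1)) (k + 1)) := by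
          refine mul_le_mul_of_nonneg_left (hnum.trans ?_) (by positivity)
          gcongr
      _ = (Real.exp (2 * b) * (12 ^ (3 / 2 : ℝ) * (6 / (b / 4) ^ 4))) *
          Real.exp (-(d * (s + r + r))) * splitWeight (k + 1 + (l + 1)) (k + 1) := by ring
      _ ≤ _ := by
          have := splitWeight_nonneg (k + 1 + (l + 1)) (k + 1)
          gcongr

/-! ### Families of Gaussian walks with branching increments -/

theorem ProbabilityTheory.IsGaussianProcess.of_linear_comb {S T Ω : Type*} [MeasurableSpace Ω]
    {P : Measure Ω} {X : T → Ω → ℝ} (hX : IsGaussianProcess X P) {Y : S → Ω → ℝ} (f g : S → T)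
    (a b : S → ℝ) (h : ∀ s ω, Y s ω = a s * X (f s) ω + b s * X (g s) ω) :
    IsGaussianProcess Y P := by
  classical
  exact hX.of_isGaussianProcess fun s => ⟨{f s, g s},
    { toFun := fun x => a s * x ⟨f s, by simp⟩ + b s * x ⟨g s, by simp⟩
      map_add' := fun x y => by simp; ring
      map_smul' := fun c x => by simp; ring
      cont := by fun_prop },
    fun ω => by simp [h]⟩

theorem lintegral_indepFun_prod {Ω α β : Type*} [MeasurableSpace Ω] [MeasurableSpace α]
    [MeasurableSpace β] {P : Measure Ω} [IsProbabilityMeasure P] {U : Ω → α} {V : Ω → β}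
    (hU : Measurable U) (hV : Measurable V) (hUV : IndepFun U V P) {F : α → β → ℝ≥0∞}
    (hF : Measurable (Function.uncurry F)) :
    ∫⁻ ω, F (U ω) (V ω) ∂P = ∫⁻ ω, ∫⁻ y, F (U ω) y ∂(P.map V) ∂P := by
  have : IsProbabilityMeasure (P.map V) := Measure.isProbabilityMeasure_map hV.aemeasurable
  have : IsProbabilityMeasure (P.map U) := Measure.isProbabilityMeasure_map hU.aemeasurable
  have h1 : ∫⁻ ω, F (U ω) (V ω) ∂P =
      ∫⁻ p, Function.uncurry F p ∂(P.map fun ω => (U ω, V ω)) := by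
    rw [lintegral_map hF (hU.prodMk hV)]; rfl
  rw [h1, (indepFun_iff_map_prod_eq_prod_map_map hU.aemeasurable hV.aemeasurable).1 hUV,
    lintegral_prod _ hF.aemeasurable, lintegral_map (hF.lintegral_prod_right') hU]
  rfl

/-- The increments of a family of Gaussian walks with step variance `δ`, such that the walks `i`
and `j` have independent increments from step `σ i j` on. -/
structure IsBranchingIncrements {Ω ι : Type*} [MeasurableSpace Ω] (n : ℕ) (δ : ℝ)
    (σ : ι → ι → ℕ) (D : ℕ × ι → Ω → ℝ) (P : Measure Ω) : Prop where
  measurable : ∀ p, Measurable (D p)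
  gaussian : IsGaussianProcess D P
  centered : ∀ p, ∫ ω, D p ω ∂P = 0
  variance : ∀ k < n, ∀ i, cov[D (k, i), D (k, i); P] = δ
  cov_steps : ∀ k l, k ≠ l → ∀ i j, cov[D (k, i), D (l, j); P] = 0
  cov_split : ∀ k < n, ∀ i j, σ i j ≤ k → cov[D (k, i), D (k, j); P] = 0

section Paths
variable {ι : Type*} (δ μ : ℝ)

/-- Distance to the barrier of walk `i` after `k` steps. -/
def barrierDist (x : ℕ × ι → ℝ) (i : ι) (k : ℕ) : ℝ :=
  1 + k * (μ * δ) - ∑ l ∈ Finset.range k, x (l, i)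

/-- Conditional probability that the Brownian interpolation of walk `i` stays below the barrier
between the steps `a` and `b`. -/
noncomputable def survivalWeight (x : ℕ × ι → ℝ) (i : ι) (a b : ℕ) : ℝ≥0∞ :=
  ∏ l ∈ Finset.Ico a b, bridgeSurvival δ (barrierDist δ μ x i l) (barrierDist δ μ x i (l + 1))

/-- The history before step `k`. -/
def history (k : ℕ) (x : ℕ × ι → ℝ) : ℕ × ι → ℝ := fun p => if p.1 < k then x p else 0

theorem measurable_barrierDist (i : ι) (k : ℕ) :
    Measurable fun x : ℕ × ι → ℝ => barrierDist δ μ x i k := by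
  unfold barrierDist; fun_prop

theorem measurable_survivalWeight (i : ι) (a b : ℕ) :
    Measurable fun x : ℕ × ι → ℝ => survivalWeight δ μ x i a b := by
  unfold survivalWeight
  refine Finset.measurable_fun_prod _ fun l _ => ?_
  exact (measurable_bridgeSurvival δ).comp
    ((measurable_barrierDist δ μ i l).prodMk (measurable_barrierDist δ μ i (l + 1)))

theorem measurable_history (k : ℕ) : Measurable (history (ι := ι) k) := by
  unfold history
  refine measurable_pi_lambda _ fun p => ?_
  split_ifs <;> fun_prop

theorem barrierDist_zero (x : ℕ × ι → ℝ) (i : ι) : barrierDist δ μ x i 0 = 1 := by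
  simp [barrierDist]

theorem barrierDist_succ (x : ℕ × ι → ℝ) (i : ι) (k : ℕ) :
    barrierDist δ μ x i (k + 1) = barrierDist δ μ x i k + μ * δ - x (k, i) := by
  simp only [barrierDist, Finset.sum_range_succ]; push_cast; ring

theorem barrierDist_history (x : ℕ × ι → ℝ) (i : ι) {k l : ℕ} (h : l ≤ k) :
    barrierDist δ μ (history k x) i l = barrierDist δ μ x i l := by
  unfold barrierDist
  congr 1
  refine Finset.sum_congr rfl fun m hm => ?_
  rw [Finset.mem_range] at hm
  simp [history, show m < k by omega]

theorem survivalWeight_history (x : ℕ × ι → ℝ) (i : ι) (a : ℕ) {b k : ℕ} (h : b ≤ k) :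
    survivalWeight δ μ (history k x) i a b = survivalWeight δ μ x i a b := by
  unfold survivalWeight
  refine Finset.prod_congr rfl fun l hl => ?_
  rw [Finset.mem_Ico] at hl
  rw [barrierDist_history _ _ _ _ (by omega), barrierDist_history _ _ _ _ (by omega)]

theorem survivalWeight_self (x : ℕ × ι → ℝ) (i : ι) (a : ℕ) : survivalWeight δ μ x i a a = 1 := by
  simp [survivalWeight]

theorem survivalWeight_succ (x : ℕ × ι → ℝ) (i : ι) {a b : ℕ} (h : a ≤ b) :
    survivalWeight δ μ x i a (b + 1) = survivalWeight δ μ x i a b *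
      bridgeSurvival δ (barrierDist δ μ x i b) (barrierDist δ μ x i b + μ * δ - x (b, i)) := by
  simp only [survivalWeight, Finset.prod_Ico_succ_top h, barrierDist_succ]

theorem survivalWeight_mul (x : ℕ × ι → ℝ) (i : ι) {a b c : ℕ} (h : a ≤ b) (h' : b ≤ c) :
    survivalWeight δ μ x i a b * survivalWeight δ μ x i b c = survivalWeight δ μ x i a c :=
  Finset.prod_Ico_consecutive _ h h'

theorem survivalWeight_le_one (x : ℕ × ι → ℝ) (i : ι) (a b : ℕ) : survivalWeight δ μ x i a b ≤ 1 :=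
  Finset.prod_le_one' fun _ _ => bridgeSurvival_le_one _ _ _

end Paths

namespace IsBranchingIncrements
variable {Ω ι : Type*} [MeasurableSpace Ω] {n : ℕ} {δ : ℝ} {σ : ι → ι → ℕ}
  {D : ℕ × ι → Ω → ℝ} {P : Measure Ω}

/-- Jointly Gaussian and uncorrelated implies independent. Zeroing the later coordinates keeps one
index type for every k. -/
theorem indepFun_history [IsProbabilityMeasure P] (h : IsBranchingIncrements n δ σ D P) (k : ℕ) :
    IndepFun (fun ω => history k fun p => D p ω) (fun ω i => D (k, i) ω) P := by
  have hG : IsGaussianProcess (Sum.elim (fun p ω => history k (fun p => D p ω) p)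
      (fun i ω => D (k, i) ω)) P := by
    refine h.gaussian.of_linear_comb (Sum.elim id fun i => (k, i)) (Sum.elim id fun i => (k, i))
      (Sum.elim (fun p => if p.1 < k then 1 else 0) fun _ => 1) (fun _ => 0) ?_
    rintro (p | i) ω <;> simp [history]
  refine hG.indepFun_of_covariance_eq_zero (fun p => ?_)
    (fun i => (h.measurable _).aemeasurable) fun p i => ?_
  · exact ((measurable_pi_apply p).comp
      ((measurable_history k).comp (measurable_pi_lambda _ h.measurable))).aemeasurable
  · by_cases hp : p.1 < k
    · simp only [history, hp, if_true]
      exact h.cov_steps _ _ hp.ne _ _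
    · simp only [history, hp, if_false]
      exact covariance_zero_left

theorem map_eq [IsProbabilityMeasure P] (h : IsBranchingIncrements n δ σ D P) {k : ℕ} (hk : k < n)
    (i : ι) : P.map (D (k, i)) = gaussianReal 0 δ.toNNReal := by
  rw [(h.gaussian.hasGaussianLaw_eval (k, i)).map_eq_gaussianReal, h.centered,
    ← covariance_self (h.measurable _).aemeasurable, h.variance k hk]

theorem indepFun_split [IsProbabilityMeasure P] (h : IsBranchingIncrements n δ σ D P) {k : ℕ}
    (hk : k < n) {i j : ι} (hij : σ i j ≤ k) : IndepFun (D (k, i)) (D (k, j)) P := by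
  have hG : IsGaussianProcess (Sum.elim (fun _ : Unit => D (k, i)) (fun _ : Unit => D (k, j))) P := by
    refine h.gaussian.of_linear_comb (Sum.elim (fun _ => (k, i)) fun _ => (k, j))
      (Sum.elim (fun _ => (k, i)) fun _ => (k, j)) (fun _ => 1) (fun _ => 0) ?_
    rintro (p | i) ω <;> simp
  have := hG.indepFun_of_covariance_eq_zero (fun _ => (h.measurable _).aemeasurable)
    (fun i => (h.measurable _).aemeasurable) fun _ _ => h.cov_split k hk i j hij
  exact this.comp (measurable_pi_apply ()) (measurable_pi_apply ())

theorem measurable_history_comp (h : IsBranchingIncrements n δ σ D P) (k : ℕ) :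
    Measurable fun ω => history k fun p => D p ω :=
  (measurable_history k).comp (measurable_pi_lambda _ h.measurable)

theorem lintegral_step [IsProbabilityMeasure P] (h : IsBranchingIncrements n δ σ D P) {k : ℕ}
    (hk : k < n) (i : ι) {F : (ℕ × ι → ℝ) → ℝ → ℝ≥0∞} (hF : Measurable (Function.uncurry F)) :
    ∫⁻ ω, F (history k fun p => D p ω) (D (k, i) ω) ∂P =
      ∫⁻ ω, ∫⁻ y, F (history k fun p => D p ω) y ∂(gaussianReal 0 δ.toNNReal) ∂P := by
  have hind : IndepFun (fun ω => history k fun p => D p ω) (D (k, i)) P :=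
    (h.indepFun_history k).comp measurable_id (measurable_pi_apply i)
  rw [lintegral_indepFun_prod (h.measurable_history_comp k) (h.measurable _) hind hF, h.map_eq hk]

theorem lintegral_step_pair [IsProbabilityMeasure P] (h : IsBranchingIncrements n δ σ D P) {k : ℕ}
    (hk : k < n) {i j : ι} (hij : σ i j ≤ k) {Φ : (ℕ × ι → ℝ) → ℝ≥0∞} (hΦ : Measurable Φ)
    {F G : (ℕ × ι → ℝ) → ℝ → ℝ≥0∞}
    (hF : Measurable (Function.uncurry F)) (hG : Measurable (Function.uncurry G)) :
    ∫⁻ ω, Φ (history k fun p => D p ω) * (F (history k fun p => D p ω) (D (k, i) ω) *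
        G (history k fun p => D p ω) (D (k, j) ω)) ∂P =
      ∫⁻ ω, Φ (history k fun p => D p ω) *
        ((∫⁻ y, F (history k fun p => D p ω) y ∂(gaussianReal 0 δ.toNNReal)) *
        ∫⁻ y, G (history k fun p => D p ω) y ∂(gaussianReal 0 δ.toNNReal)) ∂P := by
  have hmeas : Measurable (Function.uncurry fun (x : ℕ × ι → ℝ) (y : ℝ × ℝ) =>
      Φ x * (F x y.1 * G x y.2)) := by
    have h1 : Measurable fun q : (ℕ × ι → ℝ) × (ℝ × ℝ) => F q.1 q.2.1 :=
      hF.comp (by fun_prop : Measurable fun q : (ℕ × ι → ℝ) × (ℝ × ℝ) => (q.1, q.2.1))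
    have h2 : Measurable fun q : (ℕ × ι → ℝ) × (ℝ × ℝ) => G q.1 q.2.2 :=
      hG.comp (by fun_prop : Measurable fun q : (ℕ × ι → ℝ) × (ℝ × ℝ) => (q.1, q.2.2))
    exact (hΦ.comp measurable_fst).mul (h1.mul h2)
  have hind : IndepFun (fun ω => history k fun p => D p ω) (fun ω => (D (k, i) ω, D (k, j) ω)) P :=
    (h.indepFun_history k).comp measurable_id
      ((measurable_pi_apply i).prodMk (measurable_pi_apply j))
  refine (lintegral_indepFun_prod (h.measurable_history_comp k)
    ((h.measurable (k, i)).prodMk (h.measurable (k, j))) hind hmeas).trans ?_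
  rw [(indepFun_iff_map_prod_eq_prod_map_map (h.measurable _).aemeasurable
      (h.measurable _).aemeasurable).1 (h.indepFun_split hk hij), h.map_eq hk, h.map_eq hk]
  refine lintegral_congr fun ω => ?_
  have hF' : Measurable (F (history k fun p => D p ω)) := hF.of_uncurry_left
  have hG' : Measurable (G (history k fun p => D p ω)) := hG.of_uncurry_left
  rw [lintegral_const_mul, lintegral_prod_mul hF'.aemeasurable hG'.aemeasurable]
  exact (hF'.comp measurable_fst).mul (hG'.comp measurable_snd)

theorem measurable_step {f : ℝ → ℝ≥0∞} (hf : Measurable f) (δ μ : ℝ) (i : ι) (k : ℕ) :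
    Measurable (Function.uncurry fun (x : ℕ × ι → ℝ) (y : ℝ) =>
      bridgeSurvival δ (barrierDist δ μ x i k) (barrierDist δ μ x i k + μ * δ - y) *
        f (barrierDist δ μ x i k + μ * δ - y)) := by
  have hb : Measurable fun q : (ℕ × ι → ℝ) × ℝ => barrierDist δ μ q.1 i k :=
    (measurable_barrierDist δ μ i k).comp measurable_fst
  refine Measurable.mul ?_ (hf.comp ((hb.add_const _).sub measurable_snd))
  exact (measurable_bridgeSurvival δ).comp (hb.prodMk ((hb.add_const _).sub measurable_snd))

/-- Markov property: integrating out the last increment, which is independent of the history,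
replaces f by `killedStep δ μ f`. -/
theorem lintegral_survivalWeight [IsProbabilityMeasure P] (h : IsBranchingIncrements n δ σ D P)
    (μ : ℝ) (i : ι) {k : ℕ} (hk : k ≤ n) {f : ℝ → ℝ≥0∞} (hf : Measurable f) :
    ∫⁻ ω, survivalWeight δ μ (fun p => D p ω) i 0 k *
      f (barrierDist δ μ (fun p => D p ω) i k) ∂P = (killedStep δ μ)^[k] f 1 := by
  induction k generalizing f with
  | zero => simp [survivalWeight_self, barrierDist_zero]
  | succ k ih =>
    rw [Function.iterate_succ_apply, ← ih (by omega) (measurable_killedStep δ μ hf)]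
    have := h.lintegral_step (k := k) (by omega) i (F := fun x y => survivalWeight δ μ x i 0 k *
      (bridgeSurvival δ (barrierDist δ μ x i k) (barrierDist δ μ x i k + μ * δ - y) *
        f (barrierDist δ μ x i k + μ * δ - y)))
      (((measurable_survivalWeight δ μ i 0 k).comp measurable_fst).mul (measurable_step hf δ μ i k))
    simp only [survivalWeight_history _ _ _ _ _ le_rfl, barrierDist_history _ _ _ _ le_rfl] at this
    simp only [survivalWeight_succ _ _ _ _ (Nat.zero_le k), barrierDist_succ, mul_assoc]
    rw [this]
    refine lintegral_congr fun ω => ?_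
    rw [lintegral_const_mul]
    · rfl
    · exact (measurable_step hf δ μ i k).of_uncurry_left (x := fun p => D p ω)

/-- After the split the last increments of both walks are independent of each other and of the past,
so they can be peeled off together. Φ carries any weight depending only on the past before s. -/
theorem lintegral_survivalWeight_pair [IsProbabilityMeasure P]
    (h : IsBranchingIncrements n δ σ D P) (μ : ℝ) {i j : ι} {s : ℕ} (hs : σ i j ≤ s)
    {Φ : (ℕ × ι → ℝ) → ℝ≥0∞} (hΦ : Measurable Φ)
    (hΦs : ∀ x, ∀ k, s ≤ k → Φ (history k x) = Φ x) (m : ℕ) (hm : s + m ≤ n) {f g : ℝ → ℝ≥0∞}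
    (hf : Measurable f) (hg : Measurable g) :
    ∫⁻ ω, Φ (fun p => D p ω) *
      ((survivalWeight δ μ (fun p => D p ω) i s (s + m) *
        f (barrierDist δ μ (fun p => D p ω) i (s + m))) *
      (survivalWeight δ μ (fun p => D p ω) j s (s + m) *
        g (barrierDist δ μ (fun p => D p ω) j (s + m)))) ∂P =
    ∫⁻ ω, Φ (fun p => D p ω) *
      ((killedStep δ μ)^[m] f (barrierDist δ μ (fun p => D p ω) i s) *
        (killedStep δ μ)^[m] g (barrierDist δ μ (fun p => D p ω) j s)) ∂P := by
  induction m generalizing f g with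
  | zero => simp [survivalWeight_self]
  | succ m ih =>
    simp only [Function.iterate_succ_apply]
    rw [← ih (by omega) (measurable_killedStep δ μ hf) (measurable_killedStep δ μ hg)]
    have := h.lintegral_step_pair (k := s + m) (by omega) (by omega : σ i j ≤ s + m)
      (Φ := fun x => Φ x * survivalWeight δ μ x i s (s + m) * survivalWeight δ μ x j s (s + m))
      ((hΦ.mul (measurable_survivalWeight δ μ i _ _)).mul (measurable_survivalWeight δ μ j _ _))
      (measurable_step hf δ μ i (s + m)) (measurable_step hg δ μ j (s + m))
    simp only [survivalWeight_history _ _ _ _ _ le_rfl, barrierDist_history _ _ _ _ le_rfl,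
      hΦs _ (s + m) (by omega)] at this
    simp only [← add_assoc, survivalWeight_succ _ _ _ _ (Nat.le_add_right s m), barrierDist_succ]
    calc _ = _ := lintegral_congr fun ω => by ring
      _ = _ := this
      _ = _ := lintegral_congr fun ω => by unfold killedStep; ring

end IsBranchingIncrements

/-! ### The second moment method -/

theorem sq_lintegral_le_lintegral_sq_mul {Ω : Type*} [MeasurableSpace Ω] {P : Measure Ω}
    {Z : Ω → ℝ≥0∞} (hZ : Measurable Z) :
    (∫⁻ ω, Z ω ∂P) ^ 2 ≤ (∫⁻ ω, Z ω ^ 2 ∂P) * P {ω | Z ω ≠ 0} := by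
  have hS : MeasurableSet {ω | Z ω ≠ 0} := hZ (measurableSet_singleton 0).compl
  have h := ENNReal.lintegral_mul_le_Lp_mul_Lq P (p := 2) (q := 2)
    (Real.HolderConjugate.two_two) hZ.aemeasurable
    ((measurable_one : Measurable (1 : Ω → ℝ≥0∞)).indicator hS).aemeasurable
  have e1 : ∀ ω, (Z * {ω | Z ω ≠ 0}.indicator (1 : Ω → ℝ≥0∞)) ω = Z ω := by
    intro ω
    by_cases hω : Z ω = 0 <;> simp [hω]
  have e2 : ∀ ω, {ω | Z ω ≠ 0}.indicator (1 : Ω → ℝ≥0∞) ω ^ (2 : ℝ) =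
      {ω | Z ω ≠ 0}.indicator (1 : Ω → ℝ≥0∞) ω := by
    intro ω
    by_cases hω : Z ω = 0 <;> simp [hω]
  simp only [e1, e2, lintegral_indicator_one hS, ENNReal.rpow_two] at h
  calc _ ≤ ((∫⁻ ω, Z ω ^ 2 ∂P) ^ (1 / 2 : ℝ) * P {ω | Z ω ≠ 0} ^ (1 / 2 : ℝ)) ^ 2 :=
        pow_le_pow_left₀ bot_le h 2
    _ = _ := by
        rw [mul_pow, ← ENNReal.rpow_natCast, ← ENNReal.rpow_natCast, ← ENNReal.rpow_mul,
          ← ENNReal.rpow_mul]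
        norm_num

theorem ENNReal.mul_le_sq_add_sq (a b : ℝ≥0∞) : a * b ≤ a ^ 2 + b ^ 2 := by
  rcases le_total a b with h | h
  · calc a * b ≤ b * b := by gcongr
      _ = b ^ 2 := (sq b).symm
      _ ≤ _ := le_add_self
  · calc a * b ≤ a * a := by gcongr
      _ = a ^ 2 := (sq a).symm
      _ ≤ _ := le_self_add

namespace IsBranchingIncrements
variable {Ω ι : Type*} [MeasurableSpace Ω] {n : ℕ} {δ : ℝ} {σ : ι → ι → ℕ}
  {D : ℕ × ι → Ω → ℝ} {P : Measure Ω}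

/-- Weighted indicator that walk `i` stays below the barrier and ends above the target height. -/
noncomputable def hitWeight (δ μ : ℝ) (n : ℕ) (x : ℕ × ι → ℝ) (i : ι) : ℝ≥0∞ :=
  survivalWeight δ μ x i 0 n * unitTarget (barrierDist δ μ x i n)

theorem measurable_hitWeight (δ μ : ℝ) (n : ℕ) (i : ι) :
    Measurable fun x : ℕ × ι → ℝ => hitWeight δ μ n x i :=
  (measurable_survivalWeight δ μ i 0 n).mul
    (measurable_unitTarget.comp (measurable_barrierDist δ μ i n))

theorem le_sum_of_hitWeight_ne_zero {δ μ : ℝ} {n : ℕ} {x : ℕ × ι → ℝ} {i : ι}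
    (h : hitWeight δ μ n x i ≠ 0) : n * (μ * δ) ≤ ∑ l ∈ Finset.range n, x (l, i) := by
  have h1 : barrierDist δ μ x i n ∈ Set.Ioc (0 : ℝ) 1 :=
    Set.mem_of_indicator_ne_zero (right_ne_zero_of_mul h)
  have h2 := h1.2
  unfold barrierDist at h2
  linarith

/-- No information on the joint law before the split is needed: the minimum of the two survival
weights bounds their product, and it can be replaced by the weight of whichever walk carries the
squared term. -/
theorem lintegral_hitWeight_mul_le [IsProbabilityMeasure P]
    (h : IsBranchingIncrements n δ σ D P) (μ : ℝ) {i j : ι} (hσ : σ i j ≤ n) :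
    ∫⁻ ω, hitWeight δ μ n (fun p => D p ω) i * hitWeight δ μ n (fun p => D p ω) j ∂P ≤
      2 * (killedStep δ μ)^[σ i j]
        (fun x => ((killedStep δ μ)^[n - σ i j] unitTarget x) ^ 2) 1 := by
  set s := σ i j with hs
  set g := (killedStep δ μ)^[n - s] unitTarget with hg
  have hgm : Measurable g := measurable_killedStep_iterate _ _ measurable_unitTarget _
  set Φ : (ℕ × ι → ℝ) → ℝ≥0∞ := fun x => min (survivalWeight δ μ x i 0 s) (survivalWeight δ μ x j 0 s)
  have hΦ : Measurable Φ :=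
    (measurable_survivalWeight δ μ i 0 s).min (measurable_survivalWeight δ μ j 0 s)
  have hΦs : ∀ x, ∀ k, s ≤ k → Φ (history k x) = Φ x := fun x k hk => by
    simp only [Φ, survivalWeight_history _ _ _ _ _ hk]
  have key := h.lintegral_survivalWeight_pair μ (i := i) (j := j) (s := s) le_rfl hΦ hΦs (n - s)
    (by omega) measurable_unitTarget measurable_unitTarget
  rw [Nat.add_sub_cancel' hσ] at key
  have hXm : ∀ i, Measurable fun ω => survivalWeight δ μ (fun p => D p ω) i 0 s *
      g (barrierDist δ μ (fun p => D p ω) i s) ^ 2 := fun i =>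
    ((measurable_survivalWeight δ μ i 0 s).comp (measurable_pi_lambda _ h.measurable)).mul
      ((hgm.comp ((measurable_barrierDist δ μ i s).comp
        (measurable_pi_lambda _ h.measurable))).pow_const 2)
  calc _ ≤ ∫⁻ ω, Φ (fun p => D p ω) *
      ((survivalWeight δ μ (fun p => D p ω) i s n *
        unitTarget (barrierDist δ μ (fun p => D p ω) i n)) *
      (survivalWeight δ μ (fun p => D p ω) j s n *
        unitTarget (barrierDist δ μ (fun p => D p ω) j n))) ∂P := by
        refine lintegral_mono fun ω => ?_
        simp only [hitWeight, ← survivalWeight_mul δ μ _ _ (Nat.zero_le s) hσ]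
        have h1 : survivalWeight δ μ (fun p => D p ω) i 0 s * survivalWeight δ μ (fun p => D p ω) j 0 s
            ≤ Φ fun p => D p ω :=
          le_min (mul_le_of_le_one_right' (survivalWeight_le_one _ _ _ _ _ _))
            (mul_le_of_le_one_left' (survivalWeight_le_one _ _ _ _ _ _))
        calc _ = (survivalWeight δ μ (fun p => D p ω) i 0 s *
              survivalWeight δ μ (fun p => D p ω) j 0 s) *
              ((survivalWeight δ μ (fun p => D p ω) i s n *
                unitTarget (barrierDist δ μ (fun p => D p ω) i n)) *
              (survivalWeight δ μ (fun p => D p ω) j s n *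
                unitTarget (barrierDist δ μ (fun p => D p ω) j n))) := by ring
          _ ≤ _ := by gcongr
    _ = _ := key
    _ ≤ ∫⁻ ω, (survivalWeight δ μ (fun p => D p ω) i 0 s *
          g (barrierDist δ μ (fun p => D p ω) i s) ^ 2 +
        survivalWeight δ μ (fun p => D p ω) j 0 s *
          g (barrierDist δ μ (fun p => D p ω) j s) ^ 2) ∂P := by
        refine lintegral_mono fun ω => ?_
        refine (mul_le_mul_right (ENNReal.mul_le_sq_add_sq _ _) _).trans ?_
        rw [mul_add]
        gcongr
        · exact min_le_left _ _
        · exact min_le_right _ _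
    _ = _ := by
        rw [lintegral_add_left (hXm i), h.lintegral_survivalWeight μ i hσ (hgm.pow_const 2),
          h.lintegral_survivalWeight μ j hσ (hgm.pow_const 2), two_mul]

/-- Second moment estimate for the maximum of a branching family of Gaussian walks. -/
theorem exists_le_prob_maxHeight {d : ℕ} (hd : 1 ≤ d) {a A : ℝ} (ha : 0 < a) (hA : 0 < A) :
    ∃ c : ℝ, 0 < c ∧ ∀ {Ω ι : Type*} [MeasurableSpace Ω] [Fintype ι] {n : ℕ} {δ : ℝ}
      {σ : ι → ι → ℕ} {D : ℕ × ι → Ω → ℝ} {P : Measure Ω} [IsProbabilityMeasure P],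
      IsBranchingIncrements n δ σ D P → 1 / 2 ≤ δ → 1 ≤ n * δ →
      a * Real.exp (d * (n * δ)) ≤ Fintype.card ι → (∀ i j, σ i j ≤ n) →
      (∀ i, ∀ k ≤ n, (((Finset.univ.filter fun j => σ i j = k).card : ℕ) : ℝ) ≤
        A * Real.exp (d * ((n - k : ℕ) * δ))) →
      c ≤ P.real {ω | ∃ i, maxHeight d (n * δ) ≤ ∑ k ∈ Finset.range n, D (k, i) ω} := by
  obtain ⟨c₁, hc₁, hfirst⟩ := exists_le_killedStep_iterate hd
  obtain ⟨C, hC, hsecond⟩ := exists_killedStep_iterate_sq_le hd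
  obtain ⟨W, hW, hsum⟩ := exists_sum_splitWeight_le
  -- The ratio (N c₁ e^{-dT})² / (2ACW N e^{-dT}), using N e^{-dT} ≥ a.
  refine ⟨a * c₁ ^ 2 / (2 * A * C * W), by positivity, ?_⟩
  intro Ω ι _ _ n δ σ D P _ h hδ hT hcard hσ hcount
  have hδ0 : 0 < δ := by linarith
  have hT0 : 0 < n * δ := by linarith
  set T : ℝ := n * δ with hTdef
  set μ := maxHeight d T / T with hμ
  set N : ℝ := (Fintype.card ι : ℝ) with hN
  have hN0 : 0 < N := lt_of_lt_of_le (by positivity) hcard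
  set Z : Ω → ℝ≥0∞ := fun ω => ∑ i, hitWeight δ μ n (fun p => D p ω) i with hZdef
  have hwm : ∀ i, Measurable fun ω => hitWeight δ μ n (fun p => D p ω) i := fun i =>
    (measurable_hitWeight δ μ n i).comp (measurable_pi_lambda _ h.measurable)
  have hwm2 : ∀ i j, Measurable fun ω => hitWeight δ μ n (fun p => D p ω) i *
      hitWeight δ μ n (fun p => D p ω) j := fun i j => (hwm i).mul (hwm j)
  have hZ : Measurable Z := Finset.measurable_fun_sum _ fun i _ => hwm i
  have hEZ : ENNReal.ofReal (N * (c₁ * Real.exp (-(d * T)))) ≤ ∫⁻ ω, Z ω ∂P := by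
    rw [lintegral_finsetSum _ fun i _ => hwm i]
    have : ∀ i ∈ Finset.univ, ENNReal.ofReal (c₁ * Real.exp (-(d * T))) ≤
        ∫⁻ ω, hitWeight δ μ n (fun p => D p ω) i ∂P := fun i _ => by
      unfold hitWeight
      rw [h.lintegral_survivalWeight μ i le_rfl measurable_unitTarget]
      exact hfirst n δ hδ0 hT
    refine le_trans ?_ (Finset.sum_le_sum this)
    rw [Finset.sum_const, nsmul_eq_mul, ENNReal.ofReal_mul hN0.le, Finset.card_univ, hN,
      ENNReal.ofReal_natCast]
  have hEZ2 : ∫⁻ ω, Z ω ^ 2 ∂P ≤ ENNReal.ofReal (N * (2 * A * C * W * Real.exp (-(d * T)))) := by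
    have hexpand : ∀ ω, Z ω ^ 2 = ∑ i, ∑ j, hitWeight δ μ n (fun p => D p ω) i *
        hitWeight δ μ n (fun p => D p ω) j := fun ω => by
      rw [sq, hZdef, Finset.sum_mul_sum]
    simp_rw [hexpand]
    rw [lintegral_finsetSum _ fun i _ => Finset.measurable_fun_sum _ fun j _ => hwm2 i j]
    have hrow : ∀ i, ∫⁻ ω, ∑ j, hitWeight δ μ n (fun p => D p ω) i *
        hitWeight δ μ n (fun p => D p ω) j ∂P ≤
        ENNReal.ofReal (2 * A * C * W * Real.exp (-(d * T))) := fun i => by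
      rw [lintegral_finsetSum _ fun j _ => hwm2 i j]
      set B : ℕ → ℝ := fun k =>
        2 * (C * Real.exp (-(d * (T + (n - k : ℕ) * δ))) * splitWeight n k) with hB
      have hB0 : ∀ k, 0 ≤ B k := fun k => by
        have := splitWeight_nonneg n k
        positivity
      have hterm : ∀ j ∈ Finset.univ, ∫⁻ ω, hitWeight δ μ n (fun p => D p ω) i *
          hitWeight δ μ n (fun p => D p ω) j ∂P ≤ ENNReal.ofReal (B (σ i j)) := fun j _ => by
        refine (h.lintegral_hitWeight_mul_le μ (hσ i j)).trans ?_
        rw [hB, ENNReal.ofReal_mul (by norm_num), ENNReal.ofReal_ofNat]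
        exact mul_le_mul_right (hsecond n δ hδ hT _ (hσ i j)) _
      refine (Finset.sum_le_sum hterm).trans ?_
      rw [← ENNReal.ofReal_sum_of_nonneg fun j _ => hB0 _]
      refine ENNReal.ofReal_le_ofReal ?_
      rw [← Finset.sum_fiberwise_of_maps_to (s := Finset.univ) (t := Finset.range (n + 1))
        (g := σ i) fun j _ => Finset.mem_range.2 (Nat.lt_succ_of_le (hσ i j))]
      calc _ ≤ ∑ k ∈ Finset.range (n + 1), 2 * A * C * Real.exp (-(d * T)) * splitWeight n k := by
            refine Finset.sum_le_sum fun k hk => ?_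
            have hk' : k ≤ n := Nat.lt_succ_iff.1 (Finset.mem_range.1 hk)
            rw [Finset.sum_congr rfl fun j hj => by rw [(Finset.mem_filter.1 hj).2],
              Finset.sum_const, nsmul_eq_mul]
            -- The number of partners splitting at step k exactly offsets the extra decay for the
            -- time after the split.
            refine (mul_le_mul_of_nonneg_right (hcount i k hk') (hB0 k)).trans (le_of_eq ?_)
            have : Real.exp (d * ((n - k : ℕ) * δ)) * Real.exp (-(d * (T + (n - k : ℕ) * δ))) =
                Real.exp (-(d * T)) := by
              rw [← Real.exp_add]; congr 1; ring
            rw [← this, hB]; ring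
        _ = 2 * A * C * Real.exp (-(d * T)) * ∑ k ∈ Finset.range (n + 1), splitWeight n k := by
            rw [Finset.mul_sum]
        _ ≤ 2 * A * C * Real.exp (-(d * T)) * W := by
            gcongr
            exact hsum n
        _ = _ := by ring
    refine (Finset.sum_le_sum fun i _ => hrow i).trans (le_of_eq ?_)
    rw [Finset.sum_const, nsmul_eq_mul, ENNReal.ofReal_mul hN0.le, Finset.card_univ, hN,
      ENNReal.ofReal_natCast]
  have hsub : {ω | Z ω ≠ 0} ⊆ {ω | ∃ i, maxHeight d T ≤ ∑ k ∈ Finset.range n, D (k, i) ω} := by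
    intro ω hω
    obtain ⟨i, -, hi⟩ := Finset.exists_ne_zero_of_sum_ne_zero hω
    refine ⟨i, le_trans (le_of_eq ?_) (le_sum_of_hitWeight_ne_zero hi)⟩
    rw [hμ, mul_left_comm, ← hTdef]; field_simp
  refine le_trans ?_ (measureReal_mono hsub)
  have hCS := sq_lintegral_le_lintegral_sq_mul (P := P) hZ
  have hCS2 : ENNReal.ofReal ((N * (c₁ * Real.exp (-(d * T)))) ^ 2) ≤
      ENNReal.ofReal (N * (2 * A * C * W * Real.exp (-(d * T))) * P.real {ω | Z ω ≠ 0}) := by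
    rw [ENNReal.ofReal_pow (by positivity), 
      ENNReal.ofReal_mul (p := N * (2 * A * C * W * Real.exp (-(d * T)))) (by positivity),
      ofReal_measureReal (measure_ne_top _ _)]
    calc _ ≤ (∫⁻ ω, Z ω ∂P) ^ 2 := pow_le_pow_left₀ bot_le hEZ 2
      _ ≤ _ := hCS.trans (mul_le_mul_left hEZ2 _)
  have hreal := (ENNReal.ofReal_le_ofReal_iff (by positivity)).1 hCS2
  rw [div_le_iff₀ (by positivity)]
  have hE := Real.exp_pos (-(d * T))
  have hNE : a ≤ N * Real.exp (-(d * T)) := by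
    calc a = a * Real.exp (d * T) * Real.exp (-(d * T)) := by
          rw [mul_assoc, ← Real.exp_add]; simp
      _ ≤ _ := by gcongr
  have h3 : N * Real.exp (-(d * T)) * (N * Real.exp (-(d * T)) * c₁ ^ 2) ≤
      N * Real.exp (-(d * T)) * (P.real {ω | Z ω ≠ 0} * (2 * A * C * W)) := by
    calc _ = (N * (c₁ * Real.exp (-(d * T)))) ^ 2 := by ring
      _ ≤ _ := hreal
      _ = _ := by ring
  have h4 := le_of_mul_le_mul_left h3 (by positivity)
  exact (mul_le_mul_of_nonneg_right hNE (by positivity)).trans h4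

end IsBranchingIncrements

/-! ### Lattice geometry: split steps and separated boxes -/

/-- The step from which on the walks at the lattice points `a` and `b` have independent
increments. -/
noncomputable def splitStep {d M : ℕ} (n : ℕ) (δ : ℝ) (a b : Fin d → Fin M) : ℕ :=
  sInf {k | k = n ∨ ∃ i, Real.exp (((n : ℝ) - k) * δ) ≤ |((a i : ℕ) : ℝ) - (b i : ℕ)|}

theorem splitStep_le {d M : ℕ} (n : ℕ) (δ : ℝ) (a b : Fin d → Fin M) : splitStep n δ a b ≤ n :=
  Nat.sInf_le (Or.inl rfl)

theorem exists_exp_le_of_splitStep_le {d M : ℕ} {n : ℕ} {δ : ℝ} (hδ : 0 ≤ δ)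
    {a b : Fin d → Fin M} {k : ℕ} (h : splitStep n δ a b ≤ k) (hk : k < n) :
    ∃ i, Real.exp (((n : ℝ) - k) * δ) ≤ |((a i : ℕ) : ℝ) - (b i : ℕ)| := by
  have hmem := Nat.sInf_mem (s := {k | k = n ∨ ∃ i, Real.exp (((n : ℝ) - k) * δ) ≤
    |((a i : ℕ) : ℝ) - (b i : ℕ)|}) ⟨n, Or.inl rfl⟩
  rcases hmem with h1 | ⟨i, hi⟩
  · unfold splitStep at h; omega
  · refine ⟨i, le_trans (Real.exp_le_exp.2 ?_) hi⟩
    have : ((splitStep n δ a b : ℕ) : ℝ) ≤ k := by exact_mod_cast h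
    unfold splitStep at this
    gcongr

theorem card_abs_sub_lt_le {M : ℕ} (a : Fin M) {R : ℝ} (hR : 1 ≤ R) :
    (((Finset.univ.filter fun b : Fin M => |((a : ℕ) : ℝ) - (b : ℕ)| < R).card : ℕ) : ℝ) ≤ 3 * R := by
  have hsub : (Finset.univ.filter fun b : Fin M => |((a : ℕ) : ℝ) - (b : ℕ)| < R).card ≤
      (Finset.Icc ⌈((a : ℕ) : ℝ) - R⌉ ⌊((a : ℕ) : ℝ) + R⌋).card := by
    refine Finset.card_le_card_of_injOn (fun b => ((b : ℕ) : ℤ)) (fun b hb => ?_) ?_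
    · have hb' := (Finset.mem_filter.1 (Finset.mem_coe.1 hb)).2
      rw [abs_lt] at hb'
      rw [Finset.mem_coe, Finset.mem_Icc, Int.ceil_le, Int.le_floor]
      push_cast
      constructor <;> linarith [hb'.1, hb'.2]
    · intro b _ c _ hbc
      exact Fin.ext (Int.natCast_inj.1 hbc)
  have h2 : (((Finset.Icc ⌈((a : ℕ) : ℝ) - R⌉ ⌊((a : ℕ) : ℝ) + R⌋).card : ℕ) : ℝ) ≤ 3 * R := by
    rw [Int.card_Icc]
    have h3 : (((⌊((a : ℕ) : ℝ) + R⌋ + 1 - ⌈((a : ℕ) : ℝ) - R⌉).toNat : ℕ) : ℝ) =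
        max ((⌊((a : ℕ) : ℝ) + R⌋ + 1 - ⌈((a : ℕ) : ℝ) - R⌉ : ℤ) : ℝ) 0 := by
      rw [← Int.cast_natCast, Int.toNat_eq_max]; push_cast; rfl
    rw [h3]
    refine max_le ?_ (by linarith)
    push_cast
    have := Int.floor_le (((a : ℕ) : ℝ) + R)
    have := Int.le_ceil (((a : ℕ) : ℝ) - R)
    linarith
  exact le_trans (by exact_mod_cast hsub) h2

theorem card_splitStep_le {d M n : ℕ} {δ : ℝ} (hδ0 : 0 ≤ δ) (hδ1 : δ ≤ 1)
    (hM : (M : ℝ) ≤ Real.exp (n * δ)) (a : Fin d → Fin M) {k : ℕ} (hk : k ≤ n) :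
    (((Finset.univ.filter fun b => splitStep n δ a b = k).card : ℕ) : ℝ) ≤
      (3 * Real.exp 1) ^ d * Real.exp (d * ((n - k : ℕ) * δ)) := by
  have he : (1 : ℝ) ≤ 3 * Real.exp 1 := by linarith [Real.add_one_le_exp (1 : ℝ)]
  rcases k with _ | k
  · calc (((Finset.univ.filter fun b => splitStep n δ a b = 0).card : ℕ) : ℝ)
        ≤ ((Finset.univ : Finset (Fin d → Fin M)).card : ℕ) := by
          exact_mod_cast Finset.card_filter_le _ _
      _ = (M : ℝ) ^ d := by simp
      _ ≤ Real.exp (n * δ) ^ d := by gcongr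
      _ = 1 * Real.exp (d * ((n - 0 : ℕ) * δ)) := by rw [← Real.exp_nat_mul]; simp
      _ ≤ _ := by
          gcongr
          exact one_le_pow₀ he
  -- A pair that splits at k + 1 has not split at k, so every coordinate difference is below R. The
  -- index shift costs a factor e^δ ≤ e per coordinate.
  · set R : ℝ := Real.exp (((n : ℝ) - k) * δ) with hR
    have hkn : (k : ℝ) + 1 ≤ n := by exact_mod_cast hk
    have hR1 : 1 ≤ R := Real.one_le_exp (mul_nonneg (by linarith) hδ0)
    have hsub : (Finset.univ.filter fun b => splitStep n δ a b = k + 1) ⊆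
        Fintype.piFinset fun i => Finset.univ.filter fun c : Fin M =>
          |((a i : ℕ) : ℝ) - (c : ℕ)| < R := by
      intro b hb
      have hb' := (Finset.mem_filter.1 hb).2
      rw [Fintype.mem_piFinset]
      intro i
      rw [Finset.mem_filter]
      refine ⟨Finset.mem_univ _, ?_⟩
      by_contra hcon
      have : splitStep n δ a b ≤ k := Nat.sInf_le (Or.inr ⟨i, not_lt.1 hcon⟩)
      omega
    have hcard : (((Fintype.piFinset fun i => Finset.univ.filter fun c : Fin M =>
          |((a i : ℕ) : ℝ) - (c : ℕ)| < R).card : ℕ) : ℝ) ≤ (3 * R) ^ d := by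
      rw [Fintype.card_piFinset]
      push_cast
      calc _ ≤ ∏ _i : Fin d, (3 * R) :=
            Finset.prod_le_prod (fun i _ => by positivity) fun i _ => card_abs_sub_lt_le (a i) hR1
        _ = _ := by simp
    refine (le_trans (by exact_mod_cast Finset.card_le_card hsub) hcard).trans ?_
    have hR2 : R ≤ Real.exp 1 * Real.exp ((n - (k + 1) : ℕ) * δ) := by
      rw [← Real.exp_add, hR]
      refine Real.exp_le_exp.2 ?_
      rw [Nat.cast_sub hk]
      push_cast
      nlinarith
    calc (3 * R) ^ d ≤ (3 * (Real.exp 1 * Real.exp ((n - (k + 1) : ℕ) * δ))) ^ d := by gcongr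
      _ = _ := by rw [← mul_assoc, mul_pow, ← Real.exp_nat_mul]

/-- The lattice point with index `a` in the box number `j`. -/
noncomputable def boxPoint {d M K : ℕ} (ε : ℝ) (x : Fin K × (Fin d → Fin M)) : Fin d → ℝ :=
  fun i => ε * ((3 * M * (x.1 : ℕ) + (x.2 i : ℕ) : ℕ) : ℝ)

theorem boxPoint_mem {d M K : ℕ} {ε r : ℝ} (hε : 0 < ε) (hr : r < 1) (hM : ε * (3 * M * K) ≤ r)
    (x : Fin K × (Fin d → Fin M)) : boxPoint ε x ∈ gridSubBox d ε r := by
  have hpos : ∀ i, 0 ≤ boxPoint ε x i := fun i => by unfold boxPoint; positivity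
  have hle : ∀ i, boxPoint ε x i ≤ r := fun i => by
    refine le_trans ?_ hM
    unfold boxPoint
    refine mul_le_mul_of_nonneg_left ?_ hε.le
    have h1 : 3 * M * (x.1 : ℕ) + (x.2 i : ℕ) ≤ 3 * M * K := by
      have ha := (x.2 i).2
      calc _ ≤ 3 * M * (x.1 : ℕ) + 3 * M := by omega
        _ = 3 * M * ((x.1 : ℕ) + 1) := by ring
        _ ≤ _ := Nat.mul_le_mul_left _ x.1.2
    exact_mod_cast h1
  exact ⟨⟨⟨fun i => ((3 * M * (x.1 : ℕ) + (x.2 i : ℕ) : ℕ) : ℤ), fun i => by simp [boxPoint]⟩,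
    fun i => ⟨hpos i, (hle i).trans_lt hr⟩⟩, fun i => ⟨hpos i, hle i⟩⟩

theorem gridSubBox_mono {d : ℕ} {ε r ρ : ℝ} (h : r ≤ ρ) : gridSubBox d ε r ⊆ gridSubBox d ε ρ :=
  fun _ hv => ⟨hv.1, fun i => ⟨(hv.2 i).1, (hv.2 i).2.trans h⟩⟩

theorem abs_boxPoint_sub_of_eq {d M K : ℕ} {ε : ℝ} (hε : 0 < ε) (j : Fin K) (a b : Fin d → Fin M)
    (i : Fin d) : |boxPoint ε (j, a) i - boxPoint ε (j, b) i| =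
      ε * |((a i : ℕ) : ℝ) - (b i : ℕ)| := by
  unfold boxPoint
  rw [← mul_sub, abs_mul, abs_of_pos hε]
  congr 2; push_cast; ring

/-- Boxes start 3M apart in every coordinate while offsets inside a box are below M, so more than 2M
lattice steps separate them. -/
theorem le_abs_boxPoint_sub_of_ne {d M K : ℕ} {ε : ℝ} (hε : 0 < ε) {x y : Fin K × (Fin d → Fin M)}
    (h : x.1 ≠ y.1) (i : Fin d) : ε * (M + 1) ≤ |boxPoint ε x i - boxPoint ε y i| := by
  wlog hlt : (y.1 : ℕ) < x.1 generalizing x y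
  · rw [abs_sub_comm]
    have hne : (x.1 : ℕ) ≠ y.1 := fun e => h (Fin.ext e)
    exact this h.symm (by omega)
  unfold boxPoint
  rw [← mul_sub, abs_mul, abs_of_pos hε]
  refine mul_le_mul_of_nonneg_left (le_trans ?_ (le_abs_self _)) hε.le
  have hb := (y.2 i).2
  have h1 : 3 * M * ((y.1 : ℕ) + 1) ≤ 3 * M * (x.1 : ℕ) := Nat.mul_le_mul_left _ hlt
  have h2 : (M + 1) + (3 * M * (y.1 : ℕ) + (y.2 i : ℕ)) ≤ 3 * M * (x.1 : ℕ) + (x.2 i : ℕ) := by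
    rw [mul_add] at h1; omega
  have h3 : ((M : ℝ) + 1) + ((3 * M * (y.1 : ℕ) + (y.2 i : ℕ) : ℕ) : ℝ) ≤
      ((3 * M * (x.1 : ℕ) + (x.2 i : ℕ) : ℕ) : ℝ) := by exact_mod_cast h2
  linarith

/-! ### Covariances of the field and its increments -/

section Kernel
variable {d : ℕ} (v u : Fin d → ℝ)

theorem continuous_mbrwKernel :
    Continuous fun r : ℝ => ∏ i : Fin d, max (1 - Real.exp r * |v i - u i|) 0 := by fun_prop

theorem mbrwCov_comm (t s : ℝ) : mbrwCov v t u s = mbrwCov u s v t := by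
  unfold mbrwCov
  simp_rw [min_comm t s, abs_sub_comm]

theorem mbrwCov_of_le {t s : ℝ} (h : t ≤ s) : mbrwCov v t u s = mbrwCov v t u t := by
  simp [mbrwCov, h]

theorem mbrwCov_self (t : ℝ) : mbrwCov v t v t = t := by simp [mbrwCov]

/-- One factor of the kernel vanishes at time s and, by monotonicity of exp, at all later times. -/
theorem mbrwCov_sub_eq_zero {s t : ℝ} (hst : s ≤ t) (i : Fin d)
    (hi : 1 ≤ Real.exp s * |v i - u i|) : mbrwCov v t u t - mbrwCov v s u s = 0 := by
  unfold mbrwCov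
  rw [min_self, min_self, intervalIntegral.integral_interval_sub_left
    ((continuous_mbrwKernel v u).intervalIntegrable _ _)
    ((continuous_mbrwKernel v u).intervalIntegrable _ _)]
  rw [intervalIntegral.integral_congr (g := fun _ => (0 : ℝ))]
  · simp
  · intro r hr
    rw [Set.uIcc_of_le hst] at hr
    refine Finset.prod_eq_zero (Finset.mem_univ i) (max_eq_right ?_)
    have : Real.exp s * |v i - u i| ≤ Real.exp r * |v i - u i| := by
      gcongr; exact hr.1
    linarith

end Kernel

namespace IsMBRW
variable {Ω : Type*} [MeasurableSpace Ω] {d : ℕ} {ε : ℝ} {ξ : (Fin d → ℝ) → ℝ → Ω → ℝ}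
  {P : Measure Ω}

/-- A Gaussian process is only a.e. measurable at each index, whereas the Fubini arguments use
genuinely measurable maps. -/
theorem exists_measurable_modification (h : IsMBRW d ε ξ P) :
    ∃ ξ' : (Fin d → ℝ) → ℝ → Ω → ℝ, (∀ v t, Measurable (ξ' v t)) ∧ IsMBRW d ε ξ' P ∧
      ∀ v ∈ gridBox d ε, ∀ t ∈ Set.Icc (0 : ℝ) (Real.log (1 / ε)), ξ v t =ᵐ[P] ξ' v t := by
  classical
  have hae : ∀ v ∈ gridBox d ε, ∀ t ∈ Set.Icc (0 : ℝ) (Real.log (1 / ε)), AEMeasurable (ξ v t) P :=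
    fun v hv t ht => h.gaussian.aemeasurable (⟨v, hv⟩, ⟨t, ht⟩)
  set ξ' : (Fin d → ℝ) → ℝ → Ω → ℝ := fun v t =>
    if hvt : AEMeasurable (ξ v t) P then hvt.mk else 0 with hξ'
  have heq : ∀ v ∈ gridBox d ε, ∀ t ∈ Set.Icc (0 : ℝ) (Real.log (1 / ε)), ξ v t =ᵐ[P] ξ' v t :=
    fun v hv t ht => by
      simp only [hξ', hae v hv t ht, dif_pos]
      exact (hae v hv t ht).ae_eq_mk
  refine ⟨ξ', fun v t => ?_, ⟨?_, ?_, ?_⟩, heq⟩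
  · simp only [hξ']
    split_ifs with hvt
    · exact hvt.measurable_mk
    · exact measurable_zero
  · exact h.gaussian.congr fun p => heq _ p.1.2 _ p.2.2
  · intro v hv t ht
    rw [← integral_congr_ae (heq v hv t ht)]
    exact h.centered v hv t ht
  · intro v hv u hu t ht s hs
    rw [← h.covariance_eq v hv u hu t ht s hs]
    unfold covariance
    rw [← integral_congr_ae (heq v hv t ht), ← integral_congr_ae (heq u hu s hs)]
    refine integral_congr_ae ?_
    filter_upwards [heq v hv t ht, heq u hu s hs] with ω h1 h2
    rw [h1, h2]

variable (hm : ∀ v t, Measurable (ξ v t)) (h : IsMBRW d ε ξ P)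
include h

theorem hasGaussianLaw {v : Fin d → ℝ} (hv : v ∈ gridBox d ε) {t : ℝ}
    (ht : t ∈ Set.Icc (0 : ℝ) (Real.log (1 / ε))) : HasGaussianLaw (ξ v t) P :=
  h.gaussian.hasGaussianLaw_eval (⟨v, hv⟩, ⟨t, ht⟩)

theorem isProbabilityMeasure : IsProbabilityMeasure P := h.gaussian.isProbabilityMeasure

/-- Chernoff bound with a free tilt θ, since the variance at time t is t. -/
theorem measureReal_le_neg_le {v : Fin d → ℝ} (hv : v ∈ gridBox d ε) {t : ℝ}
    (ht : t ∈ Set.Icc (0 : ℝ) (Real.log (1 / ε))) {θ : ℝ} (hθ : 0 ≤ θ) (x : ℝ) :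
    P.real {ω | ξ v t ω ≤ -x} ≤ Real.exp (-θ * x + θ ^ 2 * t / 2) := by
  have := h.isProbabilityMeasure
  have hG := h.hasGaussianLaw hv ht
  have hmap : P.map (ξ v t) = gaussianReal 0 t.toNNReal := by
    rw [hG.map_eq_gaussianReal, h.centered v hv t ht, ← covariance_self hG.aemeasurable,
      h.covariance_eq v hv v hv t ht t ht, mbrwCov_self]
  have hmgf := mgf_gaussianReal hmap (-θ)
  have hint : Integrable (fun ω => Real.exp (-θ * ξ v t ω)) P := by
    have := integrable_exp_mul_gaussianReal (μ := 0) (v := t.toNNReal) (-θ)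
    rw [← hmap] at this
    exact this.comp_aemeasurable hG.aemeasurable
  have hc := measure_le_le_exp_mul_mgf (μ := P) (X := ξ v t) (t := -θ) (-x) (by linarith) hint
  refine hc.trans (le_of_eq ?_)
  rw [hmgf, ← Real.exp_add, Real.coe_toNNReal _ ht.1]
  congr 1; ring

theorem covariance_increment {v u : Fin d → ℝ} (hv : v ∈ gridBox d ε) (hu : u ∈ gridBox d ε)
    {s₁ t₁ s₂ t₂ : ℝ} (hs₁ : s₁ ∈ Set.Icc (0 : ℝ) (Real.log (1 / ε)))
    (ht₁ : t₁ ∈ Set.Icc (0 : ℝ) (Real.log (1 / ε))) (hs₂ : s₂ ∈ Set.Icc (0 : ℝ) (Real.log (1 / ε)))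
    (ht₂ : t₂ ∈ Set.Icc (0 : ℝ) (Real.log (1 / ε))) :
    cov[fun ω => ξ v t₁ ω - ξ v s₁ ω, fun ω => ξ u t₂ ω - ξ u s₂ ω; P] =
      mbrwCov v t₁ u t₂ - mbrwCov v t₁ u s₂ - (mbrwCov v s₁ u t₂ - mbrwCov v s₁ u s₂) := by
  have := h.isProbabilityMeasure
  rw [covariance_fun_sub_fun_sub (h.hasGaussianLaw hv ht₁).memLp_two
      (h.hasGaussianLaw hv hs₁).memLp_two (h.hasGaussianLaw hu ht₂).memLp_two
      (h.hasGaussianLaw hu hs₂).memLp_two,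
    h.covariance_eq v hv u hu t₁ ht₁ t₂ ht₂, h.covariance_eq v hv u hu t₁ ht₁ s₂ hs₂,
    h.covariance_eq v hv u hu s₁ hs₁ t₂ ht₂, h.covariance_eq v hv u hu s₁ hs₁ s₂ hs₂]
  ring

section Increments
variable {κ : Type*} {q : κ → Fin d → ℝ} {τ : ℕ → ℝ}

/-- The increment of the field at the point `q x` over the time step `k`. -/
def increment (ξ : (Fin d → ℝ) → ℝ → Ω → ℝ) (q : κ → Fin d → ℝ) (τ : ℕ → ℝ) (p : ℕ × κ) (ω : Ω) : ℝ :=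
  ξ (q p.2) (τ (p.1 + 1)) ω - ξ (q p.2) (τ p.1) ω

omit h in
theorem measurable_increment (hm : ∀ v t, Measurable (ξ v t)) (p : ℕ × κ) :
    Measurable (increment ξ q τ p) := (hm _ _).sub (hm _ _)

variable (hq : ∀ x, q x ∈ gridBox d ε) (hτ : ∀ k, τ k ∈ Set.Icc (0 : ℝ) (Real.log (1 / ε)))
include hq hτ

theorem isGaussianProcess_elim : IsGaussianProcess
    (Sum.elim (increment ξ q τ) fun x => ξ (q x) (τ 0)) P := by
  refine h.gaussian.of_linear_comb
    (Sum.elim (fun p => (⟨q p.2, hq _⟩, ⟨τ (p.1 + 1), hτ _⟩)) fun x => (⟨q x, hq _⟩, ⟨τ 0, hτ _⟩))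
    (Sum.elim (fun p => (⟨q p.2, hq _⟩, ⟨τ p.1, hτ _⟩)) fun x => (⟨q x, hq _⟩, ⟨τ 0, hτ _⟩))
    (fun _ => 1) (Sum.elim (fun _ => -1) fun _ => 0) ?_
  rintro (p | x) ω
  · simp [increment, sub_eq_add_neg]
  · simp

theorem isGaussianProcess_increment : IsGaussianProcess (increment ξ q τ) P :=
  (h.isGaussianProcess_elim hq hτ).comp_right Sum.inl

theorem integral_increment (p : ℕ × κ) : ∫ ω, increment ξ q τ p ω ∂P = 0 := by
  have := h.isProbabilityMeasure
  unfold increment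
  rw [integral_sub (h.hasGaussianLaw (hq _) (hτ _)).integrable
    (h.hasGaussianLaw (hq _) (hτ _)).integrable, h.centered _ (hq _) _ (hτ _),
    h.centered _ (hq _) _ (hτ _), sub_zero]

theorem covariance_increment_same (hmono : Monotone τ) (k : ℕ) (x y : κ) :
    cov[increment ξ q τ (k, x), increment ξ q τ (k, y); P] =
      mbrwCov (q x) (τ (k + 1)) (q y) (τ (k + 1)) - mbrwCov (q x) (τ k) (q y) (τ k) := by
  have hk : τ k ≤ τ (k + 1) := hmono (Nat.le_succ k)
  unfold increment
  rw [h.covariance_increment (hq _) (hq _) (hτ _) (hτ _) (hτ _) (hτ _), mbrwCov_of_le _ _ hk,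
    mbrwCov_comm _ _ (τ (k + 1)) (τ k), mbrwCov_of_le _ _ hk, mbrwCov_comm (q y)]
  ring

theorem covariance_increment_of_ne (hmono : Monotone τ) {k l : ℕ} (hkl : k ≠ l) (x y : κ) :
    cov[increment ξ q τ (k, x), increment ξ q τ (l, y); P] = 0 := by
  wlog hlt : k < l generalizing k l x y
  · rw [covariance_comm]
    exact this hkl.symm y x (by omega)
  unfold increment
  have h1 : τ k ≤ τ (k + 1) := hmono (Nat.le_succ k)
  have h2 : τ (k + 1) ≤ τ l := hmono hlt
  have h3 : τ l ≤ τ (l + 1) := hmono (Nat.le_succ l)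
  rw [h.covariance_increment (hq _) (hq _) (hτ _) (hτ _) (hτ _) (hτ _),
    mbrwCov_of_le _ _ (h2.trans h3), mbrwCov_of_le _ _ h2,
    mbrwCov_of_le _ _ (h1.trans (h2.trans h3)), mbrwCov_of_le _ _ (h1.trans h2)]
  ring

theorem covariance_increment_base (hmono : Monotone τ) (p : ℕ × κ) (x : κ) :
    cov[increment ξ q τ p, ξ (q x) (τ 0); P] = 0 := by
  have := h.isProbabilityMeasure
  have h1 : τ 0 ≤ τ p.1 := hmono (Nat.zero_le _)
  have h2 : τ 0 ≤ τ (p.1 + 1) := hmono (Nat.zero_le _)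
  unfold increment
  rw [covariance_fun_sub_left (h.hasGaussianLaw (hq _) (hτ _)).memLp_two
    (h.hasGaussianLaw (hq _) (hτ _)).memLp_two (h.hasGaussianLaw (hq _) (hτ _)).memLp_two,
    h.covariance_eq _ (hq _) _ (hq _) _ (hτ _) _ (hτ _),
    h.covariance_eq _ (hq _) _ (hq _) _ (hτ _) _ (hτ _),
    mbrwCov_comm, mbrwCov_of_le _ _ h2, mbrwCov_comm _ _ (τ p.1), mbrwCov_of_le _ _ h1, sub_self]

include hm in
theorem indepFun_increment_base (hmono : Monotone τ) :
    IndepFun (fun ω p => increment ξ q τ p ω) (fun ω x => ξ (q x) (τ 0) ω) P :=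
  (h.isGaussianProcess_elim hq hτ).indepFun_of_covariance_eq_zero
    (fun _ => ((hm _ _).sub (hm _ _)).aemeasurable) (fun _ => (hm _ _).aemeasurable)
    fun p x => h.covariance_increment_base hq hτ hmono p x

end Increments
end IsMBRW

/-! ### Independent boxes -/

namespace IsMBRW

section Boxes
variable {Ω : Type*} [MeasurableSpace Ω] {d : ℕ} {ε : ℝ} {ξ : (Fin d → ℝ) → ℝ → Ω → ℝ}
  {P : Measure Ω} (h : IsMBRW d ε ξ P) (hm : ∀ v t, Measurable (ξ v t)) (hε : 0 < ε)
  {M K n : ℕ} {δ : ℝ} {τ : ℕ → ℝ} (hq : ∀ x : Fin K × (Fin d → Fin M), boxPoint ε x ∈ gridBox d ε)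
  (hτ : ∀ k, τ k ∈ Set.Icc (0 : ℝ) (Real.log (1 / ε))) (hmono : Monotone τ)
include h hm hε hq hτ hmono

theorem isBranchingIncrements (hδ : 0 ≤ δ) (hstep : ∀ k < n, τ (k + 1) - τ k = δ)
    (hexp : ∀ k < n, Real.exp (τ k) * ε = Real.exp (-(((n : ℝ) - k) * δ))) (j : Fin K) :
    IsBranchingIncrements n δ (splitStep n δ) (fun p : ℕ × (Fin d → Fin M) =>
      increment ξ (boxPoint ε) τ (p.1, (j, p.2))) P where
  measurable p := measurable_increment hm _
  gaussian := (h.isGaussianProcess_increment hq hτ).comp_right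
    fun p : ℕ × (Fin d → Fin M) => (p.1, (j, p.2))
  centered p := h.integral_increment hq hτ (p.1, (j, p.2))
  variance k hk a := by
    have e := h.covariance_increment_same hq hτ hmono k (j, a) (j, a)
    rw [mbrwCov_self, mbrwCov_self, hstep k hk] at e
    exact e
  cov_steps k l hkl a b := h.covariance_increment_of_ne hq hτ hmono hkl (j, a) (j, b)
  cov_split k hk a b hab := by
    refine (h.covariance_increment_same hq hτ hmono k (j, a) (j, b)).trans ?_
    obtain ⟨i, hi⟩ := exists_exp_le_of_splitStep_le hδ hab hk
    refine mbrwCov_sub_eq_zero _ _ (hmono (Nat.le_succ k)) i ?_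
    rw [abs_boxPoint_sub_of_eq hε, ← mul_assoc, hexp k hk]
    calc (1 : ℝ) = Real.exp (-(((n : ℝ) - k) * δ)) * Real.exp (((n : ℝ) - k) * δ) := by
          rw [← Real.exp_add]; simp
      _ ≤ _ := by gcongr

/-- At the starting time the gap between boxes already kills the kernel, so increments at equal
steps are uncorrelated. At different steps they always are. -/
theorem iIndepFun_boxes (hd : 1 ≤ d) (hsep : 1 ≤ Real.exp (τ 0) * (ε * (M + 1))) :
    iIndepFun (fun (j : Fin K) ω (p : ℕ × (Fin d → Fin M)) =>
      increment ξ (boxPoint ε) τ (p.1, (j, p.2)) ω) P := by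
  refine IsGaussianProcess.iIndepFun_of_covariance_eq_zero
    (X := fun (j : Fin K) (p : ℕ × (Fin d → Fin M)) => increment ξ (boxPoint ε) τ (p.1, (j, p.2)))
    ?_ (fun _ _ => (measurable_increment hm _).aemeasurable) ?_
  · exact (h.isGaussianProcess_increment hq hτ).comp_right
      fun x : (_ : Fin K) × (ℕ × (Fin d → Fin M)) => (x.2.1, (x.1, x.2.2))
  · rintro j j' hjj ⟨k, a⟩ ⟨l, b⟩
    by_cases hkl : k = l
    · subst hkl
      rw [h.covariance_increment_same hq hτ hmono]
      refine mbrwCov_sub_eq_zero _ _ (hmono (Nat.le_succ k)) ⟨0, hd⟩ ?_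
      refine hsep.trans ?_
      have h0 := hmono (Nat.zero_le k)
      have h1 := le_abs_boxPoint_sub_of_ne hε (x := (j, a)) (y := (j', b)) hjj ⟨0, hd⟩
      gcongr
    · exact h.covariance_increment_of_ne hq hτ hmono hkl _ _

end Boxes

/-- The first error is the failure of all independent boxes to have a high increment, the second a
low value at time t₀ beneath a high increment. -/
theorem exists_measureReal_forall_le {d : ℕ} (hd : 1 ≤ d) :
    ∃ c : ℝ, 0 < c ∧ ∀ {Ω : Type*} [MeasurableSpace Ω] {ε : ℝ} {ξ : (Fin d → ℝ) → ℝ → Ω → ℝ}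
      {P : Measure Ω}, IsMBRW d ε ξ P → (∀ v t, Measurable (ξ v t)) → 0 < ε →
      ∀ r : ℝ, 0 < r → r < 1 → ∀ t₀ : ℝ, 0 ≤ t₀ → 1 ≤ Real.log (1 / ε) - t₀ → ∀ x : ℝ,
      P.real {ω | ∀ v ∈ gridSubBox d ε r, ξ v (Real.log (1 / ε)) ω ≤
          maxHeight d (Real.log (1 / ε) - t₀) - x} ≤
        Real.exp (-(c * (⌊r * Real.exp t₀ / 3⌋₊ : ℕ))) +
          Real.exp (-Real.sqrt (2 * d) * x + d * t₀) := by
  obtain ⟨c, hc, hcore⟩ := IsBranchingIncrements.exists_le_prob_maxHeight hd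
    (a := (1 / 2) ^ d) (A := (3 * Real.exp 1) ^ d) (by positivity) (by positivity)
  refine ⟨c, hc, ?_⟩
  intro Ω _ ε ξ P h hm hε r hr0 hr1 t₀ ht₀ hT x
  have hP := h.isProbabilityMeasure
  set T := Real.log (1 / ε) with hTdef
  have hεT : ε = Real.exp (-T) := by
    rw [hTdef, one_div, Real.log_inv, neg_neg, Real.exp_log hε]
  set T' := T - t₀ with hT'
  -- Since T' ≥ 1, dividing it into ⌈T'⌉ equal steps puts the step length in [1/2, 1].
  set n := ⌈T'⌉₊ with hn
  have hn0 : (0 : ℝ) < n := by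
    have := Nat.le_ceil T'
    linarith
  set δ := T' / n with hδdef
  have hnδ : n * δ = T' := by rw [hδdef]; field_simp
  have hδ1 : δ ≤ 1 := by rw [hδdef, div_le_one hn0]; exact Nat.le_ceil T'
  have hδ2 : 1 / 2 ≤ δ := by
    have := Nat.ceil_lt_add_one (show 0 ≤ T' by linarith)
    rw [hδdef, le_div_iff₀ hn0]; linarith
  have hδ0 : 0 ≤ δ := by linarith
  set M := ⌊Real.exp T'⌋₊ with hM
  have hMle : (M : ℝ) ≤ Real.exp T' := Nat.floor_le (Real.exp_pos _).le
  have hMlt : Real.exp T' < M + 1 := Nat.lt_floor_add_one _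
  have hM1 : (1 : ℝ) ≤ M := by
    have : 1 ≤ M := (Nat.one_le_floor_iff _).2 (Real.one_le_exp (by linarith))
    exact_mod_cast this
  set K := ⌊r * Real.exp t₀ / 3⌋₊ with hK
  have hKle : (K : ℝ) ≤ r * Real.exp t₀ / 3 := Nat.floor_le (by positivity)
  have hbox : ε * (3 * M * K) ≤ r := by
    calc _ ≤ ε * (3 * Real.exp T' * (r * Real.exp t₀ / 3)) := by gcongr
      _ = r * (Real.exp (-T) * Real.exp T' * Real.exp t₀) := by rw [← hεT]; ring
      _ = r := by
          rw [← Real.exp_add, ← Real.exp_add, show -T + T' + t₀ = 0 by rw [hT']; ring, Real.exp_zero,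
            mul_one]
  set q : Fin K × (Fin d → Fin M) → Fin d → ℝ := boxPoint ε with hqdef
  have hqmem : ∀ y, q y ∈ gridSubBox d ε r := boxPoint_mem hε hr1 hbox
  have hq : ∀ y, q y ∈ gridBox d ε := fun y => (hqmem y).1
  -- Time is frozen after step n so that τ stays in [0, T] for every natural number.
  set τ : ℕ → ℝ := fun k => t₀ + (min k n : ℕ) * δ with hτdef
  have hmono : Monotone τ := fun k l hkl => by
    have : ((min k n : ℕ) : ℝ) ≤ (min l n : ℕ) := by exact_mod_cast min_le_min_right n hkl
    simp only [hτdef]; gcongr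
  have hτ0 : τ 0 = t₀ := by simp [hτdef]
  have hτn : τ n = T := by simp only [hτdef, min_self, hnδ, hT']; ring
  have hτ : ∀ k, τ k ∈ Set.Icc (0 : ℝ) T := fun k => by
    refine ⟨by simp only [hτdef]; positivity, ?_⟩
    rw [← hτn]
    simp only [hτdef, min_self]
    gcongr
    exact min_le_right _ _
  have hexp : ∀ k < n, Real.exp (τ k) * ε = Real.exp (-(((n : ℝ) - k) * δ)) := fun k hk => by
    rw [hεT, ← Real.exp_add]
    simp only [hτdef, min_eq_left hk.le]
    congr 1
    have : T = t₀ + n * δ := by rw [hnδ, hT']; ring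
    rw [this]; ring
  have hsep : 1 ≤ Real.exp (τ 0) * (ε * (M + 1)) := by
    rw [hτ0, hεT]
    calc 1 = Real.exp t₀ * (Real.exp (-T) * Real.exp T') := by
          rw [← Real.exp_add, ← Real.exp_add, show t₀ + (-T + T') = 0 by rw [hT']; ring, Real.exp_zero]
      _ ≤ _ := by gcongr
  have hstep : ∀ k < n, τ (k + 1) - τ k = δ := fun k hk => by
    simp only [hτdef, min_eq_left hk.le, min_eq_left (Nat.succ_le_of_lt hk)]
    push_cast; ring
  have hbranch := h.isBranchingIncrements hm hε hq hτ hmono hδ0 hstep hexp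
  have hcard : (1 / 2 : ℝ) ^ d * Real.exp (d * (n * δ)) ≤ Fintype.card (Fin d → Fin M) := by
    rw [hnδ]
    have : Real.exp T' ≤ 2 * M := by linarith
    calc _ = (1 / 2 * Real.exp T') ^ d := by rw [mul_pow, ← Real.exp_nat_mul]
      _ ≤ (M : ℝ) ^ d := by gcongr; linarith
      _ = _ := by simp
  set inc : Ω → ℕ × (Fin K × (Fin d → Fin M)) → ℝ := fun ω p => increment ξ q τ p ω with hinc
  have hincm : Measurable inc := measurable_pi_lambda _ fun p => measurable_increment hm _
  set base : Ω → Fin K × (Fin d → Fin M) → ℝ := fun ω y => ξ (q y) (τ 0) ω with hbase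
  have hbasem : Measurable base := measurable_pi_lambda _ fun p => hm _ _
  have hind : IndepFun inc base P := h.indepFun_increment_base hm hq hτ hmono
  set m := maxHeight d T' with hmdef
  -- no box has a high increment
  set B : Set (ℕ × (Fin K × (Fin d → Fin M)) → ℝ) :=
    {u | ∀ y, ∑ k ∈ Finset.range n, u (k, y) < m} with hB
  have hBm : MeasurableSet B := by
    rw [hB, Set.ofPred_forall]
    exact MeasurableSet.iInter fun y => measurableSet_lt (by fun_prop) measurable_const
  have hPB : P (inc ⁻¹' B) ≤ ENNReal.ofReal (Real.exp (-(c * K))) := by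
    set E : Set (ℕ × (Fin d → Fin M) → ℝ) := {u | ∀ a, ∑ k ∈ Finset.range n, u (k, a) < m} with hE
    have hEm : MeasurableSet E := by
      rw [hE, Set.ofPred_forall]
      exact MeasurableSet.iInter fun y => measurableSet_lt (by fun_prop) measurable_const
    set D : Fin K → Ω → ℕ × (Fin d → Fin M) → ℝ := fun j ω p =>
      increment ξ q τ (p.1, (j, p.2)) ω with hD
    have hDm : ∀ j, Measurable (D j) := fun j =>
      measurable_pi_lambda _ fun p => measurable_increment hm _
    have hset : inc ⁻¹' B = ⋂ j ∈ (Finset.univ : Finset (Fin K)), D j ⁻¹' E := by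
      ext ω
      simp [hB, hE, hinc, hD]
    have hiind := h.iIndepFun_boxes hm hε hq hτ hmono hd hsep
    rw [hset, hiind.measure_inter_preimage_eq_mul Finset.univ fun j _ => hEm]
    have hone : ∀ j ∈ (Finset.univ : Finset (Fin K)), P (D j ⁻¹' E) ≤
        ENNReal.ofReal (Real.exp (-c)) := fun j _ => by
      have hj := hcore (hbranch j) hδ2 (by rw [hnδ]; exact hT) hcard (fun a b => splitStep_le _ _ _ _)
        fun a k hk => card_splitStep_le hδ0 hδ1 (by rw [hnδ]; exact hMle) a hk
      have hcompl : D j ⁻¹' E = {ω | ∃ a, maxHeight d (n * δ) ≤ ∑ k ∈ Finset.range n,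
          increment ξ q τ (k, (j, a)) ω}ᶜ := by
        ext ω
        simp [hE, hD, hnδ, hmdef]
      have hreal : P.real (D j ⁻¹' E) ≤ Real.exp (-c) := by
        rw [← compl_compl (D j ⁻¹' E), measureReal_compl (hDm j hEm).compl]
        rw [hcompl, compl_compl, probReal_univ]
        have := Real.add_one_le_exp (-c)
        linarith
      rw [← ofReal_measureReal (measure_ne_top _ _)]
      exact ENNReal.ofReal_le_ofReal hreal
    refine (Finset.prod_le_prod' hone).trans (le_of_eq ?_)
    rw [Finset.prod_const, Finset.card_univ, Fintype.card_fin, ← ENNReal.ofReal_pow (Real.exp_pos _).le,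
      ← Real.exp_nat_mul]
    congr 2; ring
  -- given a high increment, the base value there is not too low
  set S : Set ((ℕ × (Fin K × (Fin d → Fin M)) → ℝ) × (Fin K × (Fin d → Fin M) → ℝ)) :=
    {p | ∀ y, p.2 y + ∑ k ∈ Finset.range n, p.1 (k, y) ≤ m - x} with hS
  have hSm : MeasurableSet S := by
    rw [hS, Set.ofPred_forall]
    exact MeasurableSet.iInter fun y => measurableSet_le (by fun_prop) measurable_const
  have hsub : {ω | ∀ v ∈ gridSubBox d ε r, ξ v T ω ≤ m - x} ⊆ (fun ω => (inc ω, base ω)) ⁻¹' S := by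
    intro ω hω y
    have htel : ∑ k ∈ Finset.range n, inc ω (k, y) = ξ (q y) (τ n) ω - ξ (q y) (τ 0) ω :=
      Finset.sum_range_sub (fun k => ξ (q y) (τ k) ω) n
    simp only [htel, hbase, hτn]
    have := hω _ (hqmem y)
    linarith
  have hfub : P ((fun ω => (inc ω, base ω)) ⁻¹' S) ≤
      P (inc ⁻¹' B) + ENNReal.ofReal (Real.exp (-Real.sqrt (2 * d) * x + d * t₀)) := by
    have hF := lintegral_indepFun_prod hincm hbasem hind
      (F := fun u w => S.indicator (fun _ => (1 : ℝ≥0∞)) (u, w)) (measurable_const.indicator hSm)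
    have hL : ∫⁻ ω, S.indicator (fun _ => (1 : ℝ≥0∞)) (inc ω, base ω) ∂P =
        P ((fun ω => (inc ω, base ω)) ⁻¹' S) := by
      rw [← lintegral_indicator_one ((hincm.prodMk hbasem) hSm)]; rfl
    rw [← hL, hF]
    calc _ ≤ ∫⁻ ω, ((inc ⁻¹' B).indicator (1 : Ω → ℝ≥0∞) ω +
          ENNReal.ofReal (Real.exp (-Real.sqrt (2 * d) * x + d * t₀))) ∂P := by
          refine lintegral_mono fun ω => ?_
          have hprob : IsProbabilityMeasure (P.map base) :=
            Measure.isProbabilityMeasure_map hbasem.aemeasurable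
          have hsec : MeasurableSet (Prod.mk (inc ω) ⁻¹' S) := measurable_prodMk_left hSm
          have hinner : ∫⁻ w, S.indicator (fun _ => (1 : ℝ≥0∞)) (inc ω, w) ∂(P.map base) =
              P.map base (Prod.mk (inc ω) ⁻¹' S) := by
            rw [← lintegral_indicator_one hsec]; rfl
          rw [hinner]
          by_cases hω : inc ω ∈ B
          · have : (inc ⁻¹' B).indicator (1 : Ω → ℝ≥0∞) ω = 1 :=
              Set.indicator_of_mem (s := inc ⁻¹' B) hω _
            rw [this]
            exact prob_le_one.trans le_self_add
          · simp only [hB, Set.mem_ofPred_eq, not_forall, not_lt] at hω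
            -- y depends on the increments only, so it is a fixed point in the inner integral over
            -- the law of the base field.
            obtain ⟨y, hy⟩ := hω
            refine le_trans ?_ le_add_self
            rw [Measure.map_apply hbasem hsec, ← ofReal_measureReal (measure_ne_top _ _)]
            refine ENNReal.ofReal_le_ofReal ?_
            refine le_trans (measureReal_mono (s₂ := {ω | ξ (q y) (τ 0) ω ≤ -x}) ?_)
              ((h.measureReal_le_neg_le (hq y) (hτ 0) (Real.sqrt_nonneg (2 * d)) x).trans_eq ?_)
            · intro ω' hω'
              have := hω' y
              simp only [hbase] at this
              simp only [Set.mem_ofPred_eq]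
              linarith
            · rw [hτ0, Real.sq_sqrt (by positivity)]; congr 1; ring
      _ = _ := by
          rw [lintegral_add_right _ measurable_const, lintegral_indicator_one (hincm hBm)]
          simp
  have hfinal : P {ω | ∀ v ∈ gridSubBox d ε r, ξ v T ω ≤ m - x} ≤
      ENNReal.ofReal (Real.exp (-(c * K)) + Real.exp (-Real.sqrt (2 * d) * x + d * t₀)) := by
    rw [ENNReal.ofReal_add (Real.exp_pos _).le (Real.exp_pos _).le]
    exact (measure_mono hsub).trans (hfub.trans (by gcongr))
  exact ENNReal.toReal_le_of_le_ofReal (by positivity) hfinal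

end IsMBRW

/-! ### Choice of the starting time and conclusion -/

theorem maxHeight_le {d : ℕ} {T : ℝ} (hT : 1 ≤ T) : maxHeight d T ≤ Real.sqrt (2 * d) * T := by
  have : 0 ≤ (3 / 2) / Real.sqrt (2 * d) * Real.log T :=
    mul_nonneg (by positivity) (Real.log_nonneg hT)
  unfold maxHeight
  linarith

theorem maxHeight_sub_le {d : ℕ} {T t : ℝ} (ht : 0 ≤ t) (hT : 1 ≤ T - t) :
    maxHeight d T - Real.sqrt (2 * d) * t ≤ maxHeight d (T - t) := by
  have h1 : Real.log (T - t) ≤ Real.log T := Real.log_le_log (by linarith) (by linarith)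
  have h2 : (3 / 2) / Real.sqrt (2 * d) * Real.log (T - t) ≤
      (3 / 2) / Real.sqrt (2 * d) * Real.log T := by gcongr
  unfold maxHeight
  linarith

theorem mbrwMax_ae_eq {Ω : Type*} [MeasurableSpace Ω] {P : Measure Ω} {d : ℕ} {ε ρ : ℝ} (hε : 0 < ε)
    {ξ ξ' : (Fin d → ℝ) → ℝ → Ω → ℝ}
    (h : ∀ v ∈ gridBox d ε, ξ v (Real.log (1 / ε)) =ᵐ[P] ξ' v (Real.log (1 / ε))) :
    mbrwMax ε ρ ξ =ᵐ[P] mbrwMax ε ρ ξ' := by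
  have hall : ∀ᵐ ω ∂P, ∀ v ∈ gridBox d ε,
      ξ v (Real.log (1 / ε)) ω = ξ' v (Real.log (1 / ε)) ω :=
    (ae_ball_iff (finite_gridBox d hε).countable).2 h
  filter_upwards [hall] with ω hω
  unfold mbrwMax
  congr 1
  exact Set.image_congr fun v hv => hω v hv.1

theorem le_of_mbrwMax_le {Ω : Type*} {d : ℕ} {ε ρ : ℝ} (hε : 0 < ε) (hρ : 0 < ρ)
    {ξ : (Fin d → ℝ) → ℝ → Ω → ℝ} {ω : Ω} {y : ℝ} (h : mbrwMax ε ρ ξ ω ≤ y)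
    {v : Fin d → ℝ} (hv : v ∈ gridSubBox d ε ρ) : ξ v (Real.log (1 / ε)) ω ≤ y :=
  ((isGreatest_mbrwMax hε hρ ξ ω).2 ⟨v, hv, rfl⟩).trans h

/-- The left side decays doubly exponentially in t for positive c and r; e^t ≥ t keeps what is
needed, and the floor costs e^c. -/
theorem exp_neg_mul_floor_le {c r t : ℝ} (hc : 0 ≤ c) (hr : 0 ≤ r) :
    Real.exp (-(c * (⌊r * Real.exp t / 3⌋₊ : ℕ))) ≤ Real.exp c * Real.exp (-(c * r / 3 * t)) := by
  rw [← Real.exp_add]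
  refine Real.exp_le_exp.2 ?_
  have h1 := Nat.lt_floor_add_one (r * Real.exp t / 3)
  have h2 := Real.add_one_le_exp t
  have h3 : r * t ≤ r * Real.exp t := by gcongr; linarith
  have h4 : c * (r * t / 3) ≤ c * ((⌊r * Real.exp t / 3⌋₊ : ℕ) + 1) := by gcongr; linarith
  linarith

theorem proposition2p6 (d : ℕ) (hd : 1 ≤ d) (ρ : ℝ) (hρ : 0 < ρ) :
    ∃ c C : ℝ, 0 < c ∧ 0 < C ∧ ∃ ε₀ : ℝ, 0 < ε₀ ∧
      ∀ ε : ℝ, 0 < ε → ε < ε₀ →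
        ∀ (Ω : Type*) [MeasurableSpace Ω] (P : Measure Ω) [IsProbabilityMeasure P]
          (ξ : (Fin d → ℝ) → ℝ → Ω → ℝ), IsMBRW d ε ξ P →
          ∀ lam : ℝ, 0 ≤ lam →
            P.real {ω | mbrwMax ε ρ ξ ω ≤ mEps d ε - lam} ≤ C * Real.exp (-c * lam) := by
  obtain ⟨c₀, hc₀, hmain⟩ := IsMBRW.exists_measureReal_forall_le hd
  have hd' : (1 : ℝ) ≤ d := by exact_mod_cast hd
  set b := Real.sqrt (2 * d) with hb
  have hb0 : 0 < b := by positivity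
  have hb2 : b ^ 2 = 2 * d := Real.sq_sqrt (by positivity)
  -- A cube of side below 1 keeps the boxes inside the half-open unit cube when ρ ≥ 1.
  set r : ℝ := min ρ (1 / 2) with hr
  have hr0 : 0 < r := lt_min hρ (by norm_num)
  have hr1 : r < 1 := (min_le_right _ _).trans_lt (by norm_num)
  set c : ℝ := min (b / 4) (c₀ * r / 3 * (1 / (2 * b))) with hc
  have hcpos : 0 < c := lt_min (by positivity) (by positivity)
  -- The first two terms of C serve the case T - t₀ ≥ 1, the third the other case. Taking ε below
  -- e^{-1} gives T ≥ 1, hence log T ≥ 0.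
  refine ⟨c, Real.exp c₀ + 1 + Real.exp (3 / 2 * b ^ 2), hcpos, by positivity, Real.exp (-1),
    Real.exp_pos _, fun ε hε hε1 Ω _ P _ ξ' hξ' lam hlam => ?_⟩
  obtain ⟨ξ, hm, h, hae⟩ := hξ'.exists_measurable_modification
  have hT1 : 1 ≤ Real.log (1 / ε) := by
    rw [one_div, Real.log_inv]
    have := Real.log_lt_log hε hε1
    rw [Real.log_exp] at this
    linarith
  have hTmem : Real.log (1 / ε) ∈ Set.Icc (0 : ℝ) (Real.log (1 / ε)) := ⟨by linarith, le_rfl⟩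
  have hcongr : P.real {ω | mbrwMax ε ρ ξ' ω ≤ mEps d ε - lam} =
      P.real {ω | mbrwMax ε ρ ξ ω ≤ mEps d ε - lam} := by
    refine measureReal_congr ?_
    filter_upwards [mbrwMax_ae_eq (ρ := ρ) hε fun v hv => hae v hv _ hTmem] with ω hω
    exact congrArg (· ≤ mEps d ε - lam) hω
  rw [hcongr, show mEps d ε = maxHeight d (Real.log (1 / ε)) from rfl]
  set T := Real.log (1 / ε) with hT
  -- Then b t₀ = λ/2, and the Chernoff exponent -bλ/2 + d t₀ equals -bλ/4.
  set t₀ := lam * (1 / (2 * b)) with ht₀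
  have ht₀0 : 0 ≤ t₀ := by positivity
  have hbt : b * t₀ = lam / 2 := by rw [ht₀]; field_simp
  have hexp1 : Real.exp (-(b / 4) * lam) ≤ Real.exp (-c * lam) := by
    gcongr; exact min_le_left _ _
  have hexp2 : Real.exp (-(c₀ * r / 3 * t₀)) ≤ Real.exp (-c * lam) := by
    refine Real.exp_le_exp.2 ?_
    have : c * lam ≤ c₀ * r / 3 * (1 / (2 * b)) * lam := by gcongr; exact min_le_right _ _
    rw [ht₀]; linarith
  rcases le_or_gt 1 (T - t₀) with hcase | hcase
  · have hsub : {ω | mbrwMax ε ρ ξ ω ≤ maxHeight d T - lam} ⊆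
        {ω | ∀ v ∈ gridSubBox d ε r, ξ v T ω ≤ maxHeight d (T - t₀) - lam / 2} := by
      intro ω hω v hv
      have h1 := le_of_mbrwMax_le hε hρ hω (gridSubBox_mono (min_le_left _ _) hv)
      have h2 := maxHeight_sub_le (d := d) ht₀0 hcase
      rw [← hb, hbt] at h2
      linarith
    refine (measureReal_mono hsub).trans ?_
    refine (hmain h hm hε r hr0 hr1 t₀ ht₀0 hcase (lam / 2)).trans ?_
    have e1 := exp_neg_mul_floor_le (t := t₀) hc₀.le hr0.le
    have e2 : Real.exp (-b * (lam / 2) + d * t₀) = Real.exp (-(b / 4) * lam) := by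
      congr 1
      have : (d : ℝ) * t₀ = b * (b * t₀) / 2 := by
        rw [show (d : ℝ) = b ^ 2 / 2 by linarith]; ring
      rw [this, hbt]; ring
    rw [e2]
    calc _ ≤ Real.exp c₀ * Real.exp (-c * lam) + 1 * Real.exp (-c * lam) := by
          rw [one_mul]
          exact add_le_add (e1.trans (by gcongr)) hexp1
      _ ≤ _ := by
          rw [← add_mul]
          refine mul_le_mul_of_nonneg_right ?_ (Real.exp_pos _).le
          linarith [Real.exp_pos (3 / 2 * b ^ 2)]
  -- Here T < 1 + t₀, so the tilt b at the origin gives exponent -bλ + (3/2)b²T ≤ (3/2)b² - bλ/4.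
  · have h0 := zero_mem_gridSubBox d ε hρ
    have hsub : {ω | mbrwMax ε ρ ξ ω ≤ maxHeight d T - lam} ⊆ {ω | ξ 0 T ω ≤ -(lam - b * T)} := by
      intro ω hω
      have h1 := le_of_mbrwMax_le hε hρ hω h0
      have h2 := maxHeight_le (d := d) hT1
      rw [← hb] at h2
      simp only [Set.mem_ofPred_eq]
      linarith
    refine (measureReal_mono hsub).trans ?_
    refine (h.measureReal_le_neg_le h0.1 hTmem hb0.le _).trans ?_
    calc _ ≤ Real.exp (3 / 2 * b ^ 2 + -(b / 4) * lam) := by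
          refine Real.exp_le_exp.2 ?_
          have : b ^ 2 * T ≤ b ^ 2 * (1 + t₀) := by gcongr; linarith
          have e : b ^ 2 * t₀ = b * (lam / 2) := by rw [← hbt]; ring
          nlinarith
      _ = Real.exp (3 / 2 * b ^ 2) * Real.exp (-(b / 4) * lam) := Real.exp_add _ _
      _ ≤ Real.exp (3 / 2 * b ^ 2) * Real.exp (-c * lam) := by gcongr
      _ ≤ _ := by
          gcongr
          linarith [Real.exp_pos c₀]
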